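/- **Setting.** Let $\tilde A$ be an abelian group, $A\subset\tilde A$ a subgroup, and let $V$ be a strongly $A$-graded Möbius or conformal vertex algebra: a vertex algebra over $\mathbb C$ with vacuum $\mathbf 1$, vertex operators $Y(v,x)=\sum_{n\in\mathbb Z}v_nx^{-n-1}$, and a compatible $\mathfrak{sl}(2)$-action by operators $L(j)$, $j=-1,0,1$ (with $L(j)=\omega_{j+1}$ and the Virasoro relations in the conformal case); $V=\coprod_{n\in\mathbb Z}V_{(n)}=\coprod_{\alpha\in A}V^{(\alpha)}$, where $V_{(n)}$ is the $n$-eigenspace of $L(0)$, the two gradings are compatible, each $V^{(\alpha)}_{(n)}$ is finite-dimensional and is $0$ for $n\ll0$, $v_lV^{(\beta)}\subset V^{(\alpha+\beta)}$ for $v\in V^{(\alpha)}$, $L(j)V^{(\alpha)}\subset V^{(\alpha)}$, $\mathbf 1\in V^{(0)}_{(0)}$, and in the conformal case $\omega\in V^{(0)}_{(2)}$. A *generalized module* is a strongly $\tilde A$-graded generalized $V$-module $W$: a $V$-module with compatible $L(j)$-action satisfying the Jacobi identity, such that $W=\coprod_{n\in\mathbb C}W_{[n]}=\coprod_{\beta\in\tilde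 A}W^{(\beta)}$ compatibly, where $W_{[n]}$ is the generalized $n$-eigenspace of $L(0)$, $W^{(\beta)}_{[n]}$ is finite-dimensional, $W^{(\beta)}_{[n+k]}=0$ for $k\in\mathbb Z$ sufficiently negative, $v_lW^{(\beta)}\subset W^{(\alpha+\beta)}$ for $v\in V^{(\alpha)}$, and $L(j)W^{(\beta)}\subset W^{(\beta)}$. Module maps are linear maps commuting with all $v_n$ and $L(j)$ and preserving the $\tilde A$-grading. These form the category $\mathcal{GM}_{sg}$. The contragredient of $W$ is $W'=\coprod_{\beta,n}(W^{(\beta)}_{[n]})^*$, with $(W')^{(\beta)}=\coprod_n(W^{(-\beta)}_{[n]})^*$, $\langle Y'(v,x)w',w\rangle=\langle w',Y^o(v,x)w\rangle$, $Y^o(v,x)=Y(e^{xL(1)}(-x^{-2})^{L(0)}v,x^{-1})$ and $\langle L'(j)w',w\rangle=\langle w',L(-j)w\rangle$. Write $\overline W=\prod_{n\in\mathbb C}W_{[n]}$. One identifies $W''$ with $W$. Let $z\in\mathbb C^\times$. A $P(z)$-intertwining map of type $\binom{W_3}{W_1\,W_2}$ is a linear map $I:W_1\otimes W_2\to\overline{W_3}$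 with $I(W_1^{(\beta)}\otimes W_2^{(\gamma)})\subset\overline{W_3^{(\beta+\gamma)}}$, with the component of $I(w_1\otimes w_2)$ of weight $n-m$ equal to $0$ for $m\in\mathbb N$ sufficiently large (for each $n\in\mathbb C$, $w_1$, $w_2$), and with $$x_0^{-1}\delta\Big(\tfrac{x_1-z}{x_0}\Big)Y_3(v,x_1)I(w_1\otimes w_2)=z^{-1}\delta\Big(\tfrac{x_1-x_0}{z}\Big)I(Y_1(v,x_0)w_1\otimes w_2)+x_0^{-1}\delta\Big(\tfrac{z-x_1}{-x_0}\Big)I(w_1\otimes Y_2(v,x_1)w_2),$$ $$L(j)I(w_1\otimes w_2)=I(w_1\otimes L(j)w_2)+\sum_{i=0}^{j+1}\tbinom{j+1}{i}z^iI(L(j-i)w_1\otimes w_2),\quad j=-1,0,1.$$ For $w'\in W_3'$ put $I'(w')=w'\circ I\in(W_1\otimes W_2)^*$. If $J:N\to(W_1\otimes W_2)^*$ is a linear map on a generalized module $N$, write $J'$ for the map $W_1\otimes W_2\to\overline{N'}$ determined, when it exists, by $\langle x,J'(w)\rangle=J(x)(w)$ for $x\in N$, $w\in W_1\otimes W_2$.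 Let $\mathcal C$ be a full subcategory of $\mathcal{GM}_{sg}$ (for instance, of its full subcategory $\mathcal M_{sg}$ of the modules on which $L(0)$ is semisimple), closed under contragredients and under finite direct sums. For $W_1,W_2\in\mathrm{ob}\,\mathcal C$, a $P(z)$-product in $\mathcal C$ is a pair $(W;I)$ with $W\in\mathrm{ob}\,\mathcal C$ and $I$ a $P(z)$-intertwining map of type $\binom{W}{W_1\,W_2}$; a $P(z)$-tensor product of $W_1$ and $W_2$ in $\mathcal C$ is a $P(z)$-product $(W_0;I_0)$ in $\mathcal C$ such that for every $P(z)$-product $(W;I)$ in $\mathcal C$ there is a unique module map $\eta:W_0\to W$ with $\overline\eta\circ I_0=I$, where $\overline\eta:\overline{W_0}\to\overline W$ is the natural extension. On $(W_1\otimes W_2)^*$ define $$(Y'_{P(z)}(v,x)\lambda)(w_1\otimes w_2)=\lambda(w_1\otimes Y_2^o(v,x)w_2)+\mathrm{Res}_{x_0}z^{-1}\delta\Big(\tfrac{x^{-1}-x_0}{z}\Big)\lambda(Y_1(e^{xL(1)}(-x^{-2})^{L(0)}v,x_0)w_1\otimes w_2),$$ $$(L'_{P(z)}(j)\lambda)(w_1\otimes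 w_2)=\lambda\Big(w_1\otimes L(-j)w_2+\sum_{i=0}^{1-j}\tbinom{1-j}{i}z^iL(-j-i)w_1\otimes w_2\Big),$$ and let $((W_1\otimes W_2)^*)^{(\beta)}$ be the space of functionals vanishing on $W_1^{(\gamma)}\otimes W_2^{(\delta)}$ whenever $\gamma+\delta\neq-\beta$. Let $W_1\mathbin{\boxed{\backslash}}_{P(z)}W_2\subset(W_1\otimes W_2)^*$ be the union of the images $I'(W')$ over all $P(z)$-products $(W;I)$ of $W_1$ and $W_2$ in $\mathcal C$. To say that it is an object of $\mathcal C$ means that it is a linear subspace stable under all the operators above and that, with the restricted operators and the induced $\tilde A$-grading, it is an object of $\mathcal C$. **Proposition.** Let $W_1,W_2\in\mathrm{ob}\,\mathcal C$. (1) If $W_1\mathbin{\boxed{\backslash}}_{P(z)}W_2$ (with $Y'_{P(z)}$) is an object of $\mathcal C$, let $W_1\boxtimes_{P(z)}W_2=(W_1\mathbin{\boxed{\backslash}}_{P(z)}W_2)'$ be its contragredient, and let $i:W_1\mathbin{\boxed{\backslash}}_{P(z)}W_2\to(W_1\otimes W_2)^*$ be the inclusion. Then the map $i':W_1\otimes W_2\to\overline{W_1\boxtimes_{P(z)}W_2}$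 exists, and $(W_1\boxtimes_{P(z)}W_2;\,i')$ is a $P(z)$-tensor product of $W_1$ and $W_2$ in $\mathcal C$; in particular the $P(z)$-tensor product exists. (2) Conversely, assume that $\mathcal C$ is closed under images, i.e. for every $M\in\mathrm{ob}\,\mathcal C$, every generalized module $N$ and every module map $\phi:M\to N$, the image $\phi(M)$ is an object of $\mathcal C$. If a $P(z)$-tensor product of $W_1$ and $W_2$ in $\mathcal C$ exists, then $W_1\mathbin{\boxed{\backslash}}_{P(z)}W_2$ (with $Y'_{P(z)}$) is an object of $\mathcal C$. -/

import Mathlib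

open scoped TensorProduct

universe u

noncomputable section

namespace LogTensor

/-- The formal-variable operators carried by a space `W` on which `V` acts: `Y v n` is the component
`v_n` of `Y(v, x) = ∑ v_n x^(-n-1)`, and `Ln1`, `L0`, `L1` are the operators `L(-1)`, `L(0)`, `L(1)`
giving the action of `sl(2)`. -/
structure Operators (V W : Type*) [AddCommGroup V] [Module ℂ V] [AddCommGroup W] [Module ℂ W] where
  Y : V → ℤ → Module.End ℂ W
  Ln1 : Module.End ℂ W
  L0 : Module.End ℂ W
  L1 : Module.End ℂ W

/-- Data of a Möbius or conformal vertex algebra. `conf = none` is the Möbius case;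
`conf = some (ω, c)` is the conformal case, with conformal vector `ω` and central charge `c`. -/
structure VertexData (V : Type*) [AddCommGroup V] [Module ℂ V] extends Operators V V where
  one : V
  conf : Option (V × ℂ)

section Axioms

variable {V W : Type*} [AddCommGroup V] [Module ℂ V] [AddCommGroup W] [Module ℂ W]

/-- `g` is a direct sum decomposition of `W`. -/
def IsGrading {ι : Type*} (g : ι → Submodule ℂ W) : Prop :=
  iSupIndep g ∧ iSup g = ⊤

/-- The coefficient of `x₀^(-l-1) x₁^(-m-1) x₂^(-n-1)` in the Jacobi identity
`x₀⁻¹ δ((x₁-x₂)/x₀) Y(u,x₁) Y(v,x₂) w - x₀⁻¹ δ((x₂-x₁)/(-x₀)) Y(v,x₂) Y(u,x₁) w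
  = x₂⁻¹ δ((x₁-x₀)/x₂) Y(Y(u,x₀)v, x₂) w`.
All three sums are finite because of lower truncation. -/
def JacobiIdentity (YV : V → ℤ → Module.End ℂ V) (Y : V → ℤ → Module.End ℂ W) : Prop :=
  ∀ (u v : V) (l m n : ℤ) (w : W),
    (∑ᶠ i : ℕ, ((-1 : ℂ) ^ i * (Ring.choose l i : ℤ)) • Y u (m + l - i) (Y v (n + i) w))
      - (∑ᶠ i : ℕ, ((-1 : ℂ) ^ (l + i) * (Ring.choose l i : ℤ)) •
          Y v (n + l - i) (Y u (m + i) w))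
      = ∑ᶠ i : ℕ, ((Ring.choose m i : ℤ) : ℂ) • Y (YV u (l + i) v) (m + n - i) w

/-- The ungraded axioms for `V` acting on `W` (and, for `W = V`, on itself). In the conformal case
the operators `L(j)` are the components `ω_{j+1}` and the Virasoro relations hold (the relations
`sl2_*`, `bracket_*` then are consequences of the other axioms). -/
structure IsAction (D : VertexData V) (T : Operators V W) : Prop where
  Y_add : ∀ u v n, T.Y (u + v) n = T.Y u n + T.Y v n
  Y_smul : ∀ (a : ℂ) v n, T.Y (a • v) n = a • T.Y v n
  truncation : ∀ v w, ∃ N : ℤ, ∀ n, N ≤ n → T.Y v n w = 0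
  vacuum : ∀ n : ℤ, T.Y D.one n = if n = -1 then 1 else 0
  jacobi : JacobiIdentity D.Y T.Y
  sl2_zero_neg : T.L0 * T.Ln1 - T.Ln1 * T.L0 = T.Ln1
  sl2_zero_pos : T.L0 * T.L1 - T.L1 * T.L0 = -T.L1
  sl2_neg_pos : T.Ln1 * T.L1 - T.L1 * T.Ln1 = -(2 : ℂ) • T.L0
  bracket_neg : ∀ v n, T.Ln1 * T.Y v n - T.Y v n * T.Ln1 = T.Y (D.Ln1 v) n
  bracket_zero : ∀ v n,
    T.L0 * T.Y v n - T.Y v n * T.L0 = T.Y (D.L0 v) n + T.Y (D.Ln1 v) (n + 1)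
  bracket_pos : ∀ v n, T.L1 * T.Y v n - T.Y v n * T.L1
    = T.Y (D.L1 v) n + (2 : ℂ) • T.Y (D.L0 v) (n + 1) + T.Y (D.Ln1 v) (n + 2)
  derivative : ∀ v (n : ℤ), T.Y (D.Ln1 v) n = (-(n : ℂ)) • T.Y v (n - 1)
  conformal : ∀ ω c, D.conf = some (ω, c) →
    T.Ln1 = T.Y ω 0 ∧ T.L0 = T.Y ω 1 ∧ T.L1 = T.Y ω 2 ∧
    ∀ m n : ℤ, T.Y ω (m + 1) * T.Y ω (n + 1) - T.Y ω (n + 1) * T.Y ω (m + 1)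
      = ((m : ℂ) - n) • T.Y ω (m + n + 1)
        + (if m + n = 0 then ((m : ℂ) ^ 3 - m) / 12 * c else 0) • (1 : Module.End ℂ W)

end Axioms

/-- A strongly `A`-graded Möbius or conformal vertex algebra structure on `V`, where `A` is a
subgroup of the abelian group `At`. The weight space `V_(n)`, `n ∈ ℤ`, is the `n`-eigenspace of
`L(0)`; `gr α` is the homogeneous subspace `V^(α)`. -/
structure StronglyGradedVertexAlgebra {At : Type*} [AddCommGroup At] (A : AddSubgroup At)
    (V : Type*) [AddCommGroup V] [Module ℂ V] extends VertexData V where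
  gr : A → Submodule ℂ V
  action : IsAction toVertexData toOperators
  creation : ∀ v, Y v (-1) one = v ∧ ∀ n : ℤ, 0 ≤ n → Y v n one = 0
  wt_grading : IsGrading fun n : ℤ => Module.End.eigenspace L0 (n : ℂ)
  gr_grading : IsGrading gr
  compatible : ∀ α, gr α = ⨆ n : ℤ, gr α ⊓ Module.End.eigenspace L0 (n : ℂ)
  wt_truncation : ∀ α, ∃ N : ℤ, ∀ n < N, gr α ⊓ Module.End.eigenspace L0 (n : ℂ) = ⊥
  finite_dim : ∀ α (n : ℤ), Module.Finite ℂ ↥(gr α ⊓ Module.End.eigenspace L0 (n : ℂ))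
  one_mem : one ∈ gr 0 ⊓ Module.End.eigenspace L0 0
  Y_mem : ∀ α β, ∀ u ∈ gr α, ∀ v ∈ gr β, ∀ n, Y u n v ∈ gr (α + β)
  L_mem : ∀ α, ∀ v ∈ gr α, Ln1 v ∈ gr α ∧ L0 v ∈ gr α ∧ L1 v ∈ gr α
  conf_mem : ∀ ω c, conf = some (ω, c) → ω ∈ gr 0 ⊓ Module.End.eigenspace L0 2

section VertexAlgebra

variable {At : Type*} [AddCommGroup At] {A : AddSubgroup At}
  {V : Type*} [AddCommGroup V] [Module ℂ V]

open Classical in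
/-- The projection of a graded space to its component of degree `i`. -/
def gradedProj {ι W : Type*} [AddCommGroup W] [Module ℂ W] {g : ι → Submodule ℂ W}
    (hg : IsGrading g) (i : ι) : W →ₗ[ℂ] W :=
  (g i).subtype ∘ₗ DirectSum.component ℂ ι (fun j => g j) i ∘ₗ
    ((LinearEquiv.ofBijective (DirectSum.coeLinearMap g)
      (DirectSum.isInternal_submodule_of_iSupIndep_of_iSup_eq_top hg.1 hg.2)).symm : W →ₗ[ℂ] _)

/-- The opposite family `Z^o` of a family `Z : v, n ↦ v_(n)`:
`Z^o(v, x) = Z(e^(x L(1)) (-x^(-2))^(L(0)) v, x⁻¹)`, that is, for `v ∈ V_(h)`,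
`v^o_(n) = (-1)^h ∑_m (1/m!) (L(1)^m v)_(-n-m-2+2h)`, extended linearly to all `v`.
The sums are finite because `L(1)` is locally nilpotent on `V`. -/
def StronglyGradedVertexAlgebra.opp (S : StronglyGradedVertexAlgebra A V)
    {U : Type*} [AddCommGroup U] [Module ℂ U] (Z : V → ℤ → U) (v : V) (n : ℤ) : U :=
  ∑ᶠ h : ℤ, ∑ᶠ m : ℕ, ((-1 : ℂ) ^ h / (m.factorial : ℂ)) •
    Z ((S.L1 ^ m) (gradedProj S.wt_grading h v)) (-n - m - 2 + 2 * h)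

end VertexAlgebra

/-- A complex vector space with operators `v_n`, `L(-1)`, `L(0)`, `L(1)` and subspaces `gr β`
(to be thought of as the homogeneous subspaces `W^(β)`, `β ∈ At`); no axioms. -/
structure ModuleData (V : Type*) [AddCommGroup V] [Module ℂ V] (At : Type*) where
  carrier : Type u
  [addCommGroup : AddCommGroup carrier]
  [module : Module ℂ carrier]
  ops : Operators V carrier
  gr : At → Submodule ℂ carrier

namespace ModuleData

attribute [instance] ModuleData.addCommGroup ModuleData.module

instance {V : Type*} [AddCommGroup V] [Module ℂ V] {At : Type*} :
    CoeSort (ModuleData.{u} V At) (Type u) := ⟨ModuleData.carrier⟩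

/-- The weight space `W_[n]`: the generalized `n`-eigenspace of `L(0)`. -/
def wt {At V : Type*} [AddCommGroup V] [Module ℂ V] (W : ModuleData.{u} V At) (n : ℂ) : Submodule ℂ W :=
  W.ops.L0.maxGenEigenspace n

theorem shift_wt {At V : Type*} [AddCommGroup V] [Module ℂ V] (W : ModuleData.{u} V At) (T : Module.End ℂ W) (c : ℂ)
    (hT : W.ops.L0 * T - T * W.ops.L0 = c • T) (n : ℂ) (w : W) (hw : w ∈ W.wt n) :
    T w ∈ W.wt (n + c) := by
  have key : (W.ops.L0 - algebraMap ℂ (Module.End ℂ W) (n + c)) * T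
      = T * (W.ops.L0 - algebraMap ℂ (Module.End ℂ W) n) := by
    have h1 : W.ops.L0 * T = T * W.ops.L0 + c • T := by rw [← hT]; abel
    rw [sub_mul, mul_sub, h1, map_add, add_mul, Algebra.commutes n T, Algebra.smul_def]
    abel
  have hs : SemiconjBy T (W.ops.L0 - algebraMap ℂ (Module.End ℂ W) n)
      (W.ops.L0 - algebraMap ℂ (Module.End ℂ W) (n + c)) := key.symm
  unfold wt at hw ⊢
  rw [Module.End.mem_maxGenEigenspace] at hw ⊢
  obtain ⟨k, hk⟩ := hw
  refine ⟨k, ?_⟩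
  have h2 := LinearMap.congr_fun (hs.pow_right k) w
  simp only [Module.End.mul_apply, Algebra.algebraMap_eq_smul_one] at h2
  rw [← h2, hk, map_zero]

variable {At : Type*} [AddCommGroup At] {A : AddSubgroup At}
  {V : Type*} [AddCommGroup V] [Module ℂ V]

/-- `W` is a strongly `At`-graded generalized `V`-module, an object of `GM_sg`. The `ℂ`-grading
of a generalized module is necessarily the one by the generalized eigenspaces `W_[n]` of `L(0)`. -/
structure IsGeneralizedModule (S : StronglyGradedVertexAlgebra A V) (W : ModuleData.{u} V At) :
    Prop where
  action : IsAction S.toVertexData W.ops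
  wt_grading : IsGrading W.wt
  gr_grading : IsGrading W.gr
  compatible : ∀ β, W.gr β = ⨆ n : ℂ, W.gr β ⊓ W.wt n
  wt_truncation : ∀ β (n : ℂ), ∃ N : ℤ, ∀ k < N, W.gr β ⊓ W.wt (n + k) = ⊥
  finite_dim : ∀ β n, Module.Finite ℂ ↥(W.gr β ⊓ W.wt n)
  Y_mem : ∀ (α : A) β, ∀ v ∈ S.gr α, ∀ w ∈ W.gr β, ∀ n, W.ops.Y v n w ∈ W.gr (α + β)
  L_mem : ∀ β, ∀ w ∈ W.gr β,
    W.ops.Ln1 w ∈ W.gr β ∧ W.ops.L0 w ∈ W.gr β ∧ W.ops.L1 w ∈ W.gr β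

/-- Maps of strongly graded generalized modules. -/
structure IsHom {W X : ModuleData.{u} V At} (f : W →ₗ[ℂ] X) : Prop where
  map_Y : ∀ v n w, f (W.ops.Y v n w) = X.ops.Y v n (f w)
  map_Ln1 : ∀ w, f (W.ops.Ln1 w) = X.ops.Ln1 (f w)
  map_L0 : ∀ w, f (W.ops.L0 w) = X.ops.L0 (f w)
  map_L1 : ∀ w, f (W.ops.L1 w) = X.ops.L1 (f w)
  map_gr : ∀ β, ∀ w ∈ W.gr β, f w ∈ X.gr β

/-- `U` is stable under all the operators. -/
structure IsStable (X : ModuleData.{u} V At) (U : Submodule ℂ X) : Prop where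
  Y : ∀ v n, ∀ x ∈ U, X.ops.Y v n x ∈ U
  Ln1 : ∀ x ∈ U, X.ops.Ln1 x ∈ U
  L0 : ∀ x ∈ U, X.ops.L0 x ∈ U
  L1 : ∀ x ∈ U, X.ops.L1 x ∈ U

/-- A stable subspace `U` with the restricted operators and `U^(β) = U ∩ X^(β)`. -/
def sub (X : ModuleData.{u} V At) (U : Submodule ℂ X) (hU : X.IsStable U) :
    ModuleData.{u} V At where
  carrier := U
  ops :=
    { Y := fun v n => (X.ops.Y v n).restrict (hU.Y v n)
      Ln1 := X.ops.Ln1.restrict hU.Ln1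
      L0 := X.ops.L0.restrict hU.L0
      L1 := X.ops.L1.restrict hU.L1 }
  gr := fun β => (X.gr β).comap U.subtype

/-! ### Contragredient modules -/

/-- The space `W' = ∐_{β, n} (W_[n]^(β))^*`, as the space of the functionals on `W` that are
nonzero on only finitely many of the spaces `W_[n]^(β)`. -/
def contraSpace (W : ModuleData.{u} V At) : Submodule ℂ (Module.Dual ℂ W) where
  carrier := {f | {p : At × ℂ | ∃ w ∈ W.gr p.1 ⊓ W.wt p.2, f w ≠ 0}.Finite}
  zero_mem' := by simp
  add_mem' := by
    intro f g hf hg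
    refine (hf.union hg).subset ?_
    rintro p ⟨w, hw, h⟩
    by_cases hfw : f w = 0
    · exact Or.inr ⟨w, hw, fun hgw => h (by simp [hfw, hgw])⟩
    · exact Or.inl ⟨w, hw, hfw⟩
  smul_mem' := by
    intro a f hf
    refine hf.subset ?_
    rintro p ⟨w, hw, h⟩
    exact ⟨w, hw, fun hfw => h (by simp [hfw])⟩

theorem comp_mem_contraSpace (W : ModuleData.{u} V At) (T : Module.End ℂ W) (a : At) (c : ℂ)
    (hT : ∀ β n, ∀ w ∈ W.gr β ⊓ W.wt n, T w ∈ W.gr (a + β) ⊓ W.wt (n + c))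
    (f : Module.Dual ℂ W) (hf : f ∈ W.contraSpace) : f ∘ₗ T ∈ W.contraSpace := by
  have hinj : Function.Injective (fun p : At × ℂ => (a + p.1, p.2 + c)) := by
    rintro ⟨x, y⟩ ⟨x', y'⟩ h
    simpa using h
  refine (Set.Finite.preimage hinj.injOn hf).subset ?_
  rintro ⟨β, n⟩ ⟨w, hw, h⟩
  exact ⟨T w, hT β n w hw, h⟩

theorem Y_homogeneous (S : StronglyGradedVertexAlgebra A V) (W : ModuleData.{u} V At)
    (hW : W.IsGeneralizedModule S) (α : A) (h : ℤ) (v : V)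
    (hv : v ∈ S.gr α ⊓ Module.End.eigenspace S.L0 (h : ℂ)) (k : ℤ) (β : At) (n : ℂ) (w : W)
    (hw : w ∈ W.gr β ⊓ W.wt n) :
    W.ops.Y v k w ∈ W.gr (α + β) ⊓ W.wt (n + (h - k - 1)) := by
  refine ⟨hW.Y_mem α β v hv.1 w hw.1 k, W.shift_wt _ _ ?_ n w hw.2⟩
  have hL : S.L0 v = (h : ℂ) • v := Module.End.mem_eigenspace_iff.mp hv.2
  rw [hW.action.bracket_zero, hL, hW.action.Y_smul, hW.action.derivative, add_sub_cancel_right,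
    ← add_smul]
  congr 1
  push_cast
  ring

theorem comp_Y_mem (S : StronglyGradedVertexAlgebra A V) (W : ModuleData.{u} V At)
    (hW : W.IsGeneralizedModule S) (v : V) (k : ℤ) (f : Module.Dual ℂ W)
    (hf : f ∈ W.contraSpace) : f ∘ₗ W.ops.Y v k ∈ W.contraSpace := by
  let Q : Submodule ℂ V :=
    { carrier := {u | f ∘ₗ W.ops.Y u k ∈ W.contraSpace}
      zero_mem' := by
        have h0 : W.ops.Y 0 k = 0 := by
          have := hW.action.Y_smul 0 0 k
          simpa using this
        show f ∘ₗ W.ops.Y 0 k ∈ W.contraSpace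
        rw [h0, LinearMap.comp_zero]
        exact Submodule.zero_mem _
      add_mem' := by
        intro a b ha hb
        show f ∘ₗ W.ops.Y (a + b) k ∈ W.contraSpace
        rw [hW.action.Y_add, LinearMap.comp_add]
        exact Submodule.add_mem _ ha hb
      smul_mem' := by
        intro c a ha
        show f ∘ₗ W.ops.Y (c • a) k ∈ W.contraSpace
        rw [hW.action.Y_smul, LinearMap.comp_smul]
        exact Submodule.smul_mem _ _ ha }
  have hQ : ∀ α, S.gr α ≤ Q := by
    intro α
    rw [S.compatible α]
    refine iSup_le fun h u hu => ?_
    exact W.comp_mem_contraSpace _ α _ (W.Y_homogeneous S hW α h u hu k) f hf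
  have htop : (⊤ : Submodule ℂ V) ≤ Q := by
    rw [← S.gr_grading.2]
    exact iSup_le hQ
  exact htop (Submodule.mem_top (x := v))

theorem comp_opp_mem (S : StronglyGradedVertexAlgebra A V) (W : ModuleData.{u} V At)
    (hW : W.IsGeneralizedModule S) (v : V) (k : ℤ) (f : Module.Dual ℂ W)
    (hf : f ∈ W.contraSpace) : f ∘ₗ S.opp W.ops.Y v k ∈ W.contraSpace := by
  unfold StronglyGradedVertexAlgebra.opp
  have h0 : f ∘ₗ (0 : Module.End ℂ W) ∈ W.contraSpace := by
    rw [LinearMap.comp_zero]; exact Submodule.zero_mem _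
  have hadd : ∀ P Q : Module.End ℂ W, f ∘ₗ P ∈ W.contraSpace → f ∘ₗ Q ∈ W.contraSpace →
      f ∘ₗ (P + Q) ∈ W.contraSpace := by
    intro P Q hP hQ
    rw [LinearMap.comp_add]; exact Submodule.add_mem _ hP hQ
  refine finsum_induction (fun T => f ∘ₗ T ∈ W.contraSpace) h0 hadd fun h => ?_
  refine finsum_induction (fun T => f ∘ₗ T ∈ W.contraSpace) h0 hadd fun m => ?_
  rw [LinearMap.comp_smul]
  exact Submodule.smul_mem _ _ (W.comp_Y_mem S hW _ _ f hf)

theorem comp_L_mem (S : StronglyGradedVertexAlgebra A V) (W : ModuleData.{u} V At)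
    (hW : W.IsGeneralizedModule S) (f : Module.Dual ℂ W) (hf : f ∈ W.contraSpace) :
    f ∘ₗ W.ops.Ln1 ∈ W.contraSpace ∧ f ∘ₗ W.ops.L0 ∈ W.contraSpace ∧
      f ∘ₗ W.ops.L1 ∈ W.contraSpace := by
  refine ⟨W.comp_mem_contraSpace _ 0 1 (fun β n w hw => ⟨?_, ?_⟩) f hf,
    W.comp_mem_contraSpace _ 0 0 (fun β n w hw => ⟨?_, ?_⟩) f hf,
    W.comp_mem_contraSpace _ 0 (-1) (fun β n w hw => ⟨?_, ?_⟩) f hf⟩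
  · rw [zero_add]; exact (hW.L_mem β w hw.1).1
  · exact W.shift_wt _ _ (by rw [hW.action.sl2_zero_neg, one_smul]) n w hw.2
  · rw [zero_add]; exact (hW.L_mem β w hw.1).2.1
  · exact W.shift_wt _ _ (by rw [sub_self, zero_smul]) n w hw.2
  · rw [zero_add]; exact (hW.L_mem β w hw.1).2.2
  · exact W.shift_wt _ _ (by rw [hW.action.sl2_zero_pos, neg_one_smul]) n w hw.2

/-- The contragredient `W'` of a strongly graded generalized module: `⟨Y'(v,x)w', w⟩ =
⟨w', Y^o(v,x)w⟩`, `⟨L'(j)w', w⟩ = ⟨w', L(-j)w⟩`, and `(W')^(β)` consists of the `w'` that vanish on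
`W^(γ)` for all `γ ≠ -β`. -/
def contragredient (S : StronglyGradedVertexAlgebra A V) (W : ModuleData.{u} V At)
    (hW : W.IsGeneralizedModule S) : ModuleData.{u} V At where
  carrier := W.contraSpace
  ops :=
    { Y := fun v n => (Module.Dual.transpose (R := ℂ) (S.opp W.ops.Y v n)).restrict
        (W.comp_opp_mem S hW v n)
      Ln1 := (Module.Dual.transpose (R := ℂ) W.ops.L1).restrict
        fun f hf => (W.comp_L_mem S hW f hf).2.2
      L0 := (Module.Dual.transpose (R := ℂ) W.ops.L0).restrict
        fun f hf => (W.comp_L_mem S hW f hf).2.1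
      L1 := (Module.Dual.transpose (R := ℂ) W.ops.Ln1).restrict
        fun f hf => (W.comp_L_mem S hW f hf).1 }
  gr := fun β => (⨅ γ ∈ {γ | γ ≠ -β}, (W.gr γ).dualAnnihilator).comap W.contraSpace.subtype

/-! ### `P(z)`-intertwining maps and `P(z)`-tensor products -/

/-- A linear map `I : W₁ ⊗ W₂ → W̄₃`, where `W̄₃ = ∏_n (W₃)_[n]` is the formal completion of `W₃` and
an element of `W̄₃` is written as the family `n ↦ π_n` of its components, is a `P(z)`-intertwining
map of type `(W₃; W₁ W₂)`. If `v ∈ V_(h)`, then `v_k` acts on `f ∈ W̄₃` by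
`(v_k f)_p = v_k (f_{p+k+1-h})`, because `v_k` has weight `h - k - 1`; similarly `L(j)` has weight
`-j`. -/
structure IsIntertwiningMap (S : StronglyGradedVertexAlgebra A V) (z : ℂ)
    {W₁ W₂ W₃ : ModuleData.{u} V At} (I : W₁ ⊗[ℂ] W₂ →ₗ[ℂ] (ℂ → W₃)) : Prop where
  mem_completion : ∀ w n, I w n ∈ W₃.wt n
  grading : ∀ β γ, ∀ w₁ ∈ W₁.gr β, ∀ w₂ ∈ W₂.gr γ, ∀ n, I (w₁ ⊗ₜ w₂) n ∈ W₃.gr (β + γ)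
  truncation : ∀ w₁ w₂ (n : ℂ), ∃ N : ℕ, ∀ m : ℕ, N ≤ m → I (w₁ ⊗ₜ w₂) (n - m) = 0
  /-- The coefficient of `x₀^(-n-1) x₁^(-m-1)`, in weight `p`, of
  `x₀⁻¹ δ((x₁-z)/x₀) Y₃(v,x₁) I(w₁⊗w₂) = z⁻¹ δ((x₁-x₀)/z) I(Y₁(v,x₀)w₁⊗w₂)
    + x₀⁻¹ δ((z-x₁)/(-x₀)) I(w₁⊗Y₂(v,x₁)w₂)`
  for `v` of weight `h` (by linearity this gives the identity for all `v`). -/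
  jacobi : ∀ (h : ℤ), ∀ v ∈ Module.End.eigenspace S.L0 (h : ℂ), ∀ w₁ w₂ (n m : ℤ) (p : ℂ),
    (∑ᶠ i : ℕ, ((Ring.choose n i : ℤ) * (-z) ^ i) •
        W₃.ops.Y v (m + n - i) (I (w₁ ⊗ₜ w₂) (p + ((m + n - i : ℤ) : ℂ) + 1 - h)))
      = (∑ᶠ i : ℕ, ((Ring.choose m i : ℤ) * z ^ (m - i)) • I (W₁.ops.Y v (n + i) w₁ ⊗ₜ w₂) p)
        + ∑ᶠ i : ℕ, ((-1 : ℂ) ^ (n + i) * (Ring.choose n i : ℤ) * z ^ (n - i)) •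
            I (w₁ ⊗ₜ W₂.ops.Y v (m + i) w₂) p
  bracket_neg : ∀ w₁ w₂ p, W₃.ops.Ln1 (I (w₁ ⊗ₜ w₂) (p - 1))
    = I (w₁ ⊗ₜ W₂.ops.Ln1 w₂) p + I (W₁.ops.Ln1 w₁ ⊗ₜ w₂) p
  bracket_zero : ∀ w₁ w₂ p, W₃.ops.L0 (I (w₁ ⊗ₜ w₂) p)
    = I (w₁ ⊗ₜ W₂.ops.L0 w₂) p + I (W₁.ops.L0 w₁ ⊗ₜ w₂) p + z • I (W₁.ops.Ln1 w₁ ⊗ₜ w₂) p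
  bracket_pos : ∀ w₁ w₂ p, W₃.ops.L1 (I (w₁ ⊗ₜ w₂) (p + 1))
    = I (w₁ ⊗ₜ W₂.ops.L1 w₂) p + I (W₁.ops.L1 w₁ ⊗ₜ w₂) p
      + (2 * z) • I (W₁.ops.L0 w₁ ⊗ₜ w₂) p + z ^ 2 • I (W₁.ops.Ln1 w₁ ⊗ₜ w₂) p

/-- `(W₀; I₀)` is a `P(z)`-tensor product of `W₁` and `W₂` in the full subcategory `C`: a
`P(z)`-product in `C` from which there is a unique morphism to every `P(z)`-product `(W; I)` with `W`
in `C`, i.e. a unique module map `η` with `η̄ ∘ I₀ = I`. -/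
structure IsPzTensorProduct (S : StronglyGradedVertexAlgebra A V) (z : ℂ)
    (C : ModuleData.{u} V At → Prop) (W₁ W₂ W₀ : ModuleData.{u} V At)
    (I₀ : W₁ ⊗[ℂ] W₂ →ₗ[ℂ] (ℂ → W₀)) : Prop where
  mem : C W₀
  intertwining : IsIntertwiningMap S z I₀
  universal : ∀ (W : ModuleData.{u} V At) (I : W₁ ⊗[ℂ] W₂ →ₗ[ℂ] (ℂ → W)), C W →
    IsIntertwiningMap S z I → ∃! η : W₀ →ₗ[ℂ] W, IsHom η ∧ ∀ w n, η (I₀ w n) = I w n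

/-! ### The action on `(W₁ ⊗ W₂)^*` -/

/-- The action `τ_W(v ⊗ (z+t)^k)` on `W`, where `(z+t)^k = ∑_i (k choose i) z^(k-i) t^i`
is expanded in nonnegative powers of `t` and `v ⊗ t^i` acts as `v_i`. -/
def shiftedY (S : StronglyGradedVertexAlgebra A V) (W : ModuleData.{u} V At)
    (hW : W.IsGeneralizedModule S) (z : ℂ) (v : V) (k : ℤ) : Module.End ℂ W :=
  have hfin : ∀ w, (Function.support fun i : ℕ =>
      ((Ring.choose k i : ℤ) * z ^ (k - i)) • W.ops.Y v i w).Finite := by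
    intro w
    obtain ⟨N, hN⟩ := hW.action.truncation v w
    refine (Set.finite_Iio N.toNat).subset fun i hi => ?_
    by_contra hlt
    refine hi ?_
    have : N ≤ (i : ℤ) := by
      simp only [Set.mem_Iio, not_lt] at hlt
      omega
    simp only
    rw [hN i this, smul_zero]
  { toFun := fun w => ∑ᶠ i : ℕ, ((Ring.choose k i : ℤ) * z ^ (k - i)) • W.ops.Y v i w
    map_add' := by
      intro a b
      rw [← finsum_add_distrib (hfin a) (hfin b)]
      simp only [map_add, smul_add]
    map_smul' := by
      intro c a
      rw [RingHom.id_apply, smul_finsum' c (hfin a)]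
      simp only [map_smul, smul_comm c] }

/-- The space `(W₁ ⊗ W₂)^*` with the operators
`(Y'_{P(z)}(v)_n λ)(w₁ ⊗ w₂) = λ(τ_{W₁}(T_z (v ⊗ t^n)^o) w₁ ⊗ w₂) + λ(w₁ ⊗ τ_{W₂}((v ⊗ t^n)^o) w₂)`,
where `T_z` substitutes `z + t` for `t`, and
`(L'_{P(z)}(j) λ)(w₁ ⊗ w₂) = λ(w₁ ⊗ L(-j)w₂ + (∑_{i=0}^{1-j} (1-j choose i) z^i L(-j-i) w₁) ⊗ w₂)`,
and with the subspaces `((W₁ ⊗ W₂)^*)^(β)` of the functionals that vanish on `W₁^(γ) ⊗ W₂^(δ)`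
whenever `γ + δ ≠ -β`. -/
def tensorDual (S : StronglyGradedVertexAlgebra A V) (z : ℂ) (W₁ W₂ : ModuleData.{u} V At)
    (h₁ : W₁.IsGeneralizedModule S) : ModuleData.{u} V At where
  carrier := Module.Dual ℂ (W₁ ⊗[ℂ] W₂)
  ops :=
    { Y := fun v n => Module.Dual.transpose (R := ℂ)
        (LinearMap.rTensor W₂ (S.opp (W₁.shiftedY S h₁ z) v n)
          + LinearMap.lTensor W₁ (S.opp W₂.ops.Y v n))
      Ln1 := Module.Dual.transpose (R := ℂ)
        (LinearMap.lTensor W₁ W₂.ops.L1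
          + LinearMap.rTensor W₂ (W₁.ops.L1 + (2 * z) • W₁.ops.L0 + z ^ 2 • W₁.ops.Ln1))
      L0 := Module.Dual.transpose (R := ℂ)
        (LinearMap.lTensor W₁ W₂.ops.L0 + LinearMap.rTensor W₂ (W₁.ops.L0 + z • W₁.ops.Ln1))
      L1 := Module.Dual.transpose (R := ℂ)
        (LinearMap.lTensor W₁ W₂.ops.Ln1 + LinearMap.rTensor W₂ W₁.ops.Ln1) }
  gr := fun β =>
    { carrier := {φ | ∀ γ δ, γ + δ ≠ -β → ∀ w₁ ∈ W₁.gr γ, ∀ w₂ ∈ W₂.gr δ, φ (w₁ ⊗ₜ w₂) = 0}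
      zero_mem' := by
        intro γ δ _ w₁ _ w₂ _
        exact LinearMap.zero_apply _
      add_mem' := by
        intro f g hf hg γ δ h w₁ hw₁ w₂ hw₂
        rw [LinearMap.add_apply, hf γ δ h w₁ hw₁ w₂ hw₂, hg γ δ h w₁ hw₁ w₂ hw₂, add_zero]
      smul_mem' := by
        intro c f hf γ δ h w₁ hw₁ w₂ hw₂
        rw [LinearMap.smul_apply, hf γ δ h w₁ hw₁ w₂ hw₂, smul_zero] }

/-- The subset `W₁ ⧅_{P(z)} W₂` of `(W₁ ⊗ W₂)^*`: the union of the images `I'(W')` over all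
`P(z)`-products `(W; I)` with `W` in `C`, where `I'(w') = w' ∘ I`, that is,
`I'(w')(w) = ⟨w', I(w)⟩ = ∑_n w'(π_n I(w))`. -/
def backslash (S : StronglyGradedVertexAlgebra A V) (z : ℂ) (C : ModuleData.{u} V At → Prop)
    (W₁ W₂ : ModuleData.{u} V At) (h₁ : W₁.IsGeneralizedModule S) : Set (tensorDual S z W₁ W₂ h₁) :=
  {φ : Module.Dual ℂ (W₁ ⊗[ℂ] W₂) | ∃ (W : ModuleData.{u} V At) (I : W₁ ⊗[ℂ] W₂ →ₗ[ℂ] (ℂ → W)), C W ∧ IsIntertwiningMap S z I ∧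
    ∃ w' ∈ W.contraSpace, ∀ w, φ w = ∑ᶠ n : ℂ, w' (I w n)}

/-- For a module `N` and a linear map `J : N → (W₁ ⊗ W₂)^*`, the map `I` from `W₁ ⊗ W₂` to the formal completion of `N'`
is the map `J'` corresponding to `J` (where `N'' = N`): `⟨x, I(w)⟩ = J(x)(w)` for `x ∈ N`. -/
def IsPrime (S : StronglyGradedVertexAlgebra A V) {W₁ W₂ N : ModuleData.{u} V At}
    (hN : N.IsGeneralizedModule S) (J : N →ₗ[ℂ] Module.Dual ℂ (W₁ ⊗[ℂ] W₂))
    (I : W₁ ⊗[ℂ] W₂ →ₗ[ℂ] (ℂ → N.contragredient S hN)) : Prop :=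
  (∀ w n, I w n ∈ (N.contragredient S hN).wt n) ∧
  ∀ w x, ∑ᶠ n : ℂ, (I w n).1 x = J x w

/-! ### Full subcategories -/

/-- A full subcategory of `GM_sg` (given by its class of objects `C`) closed under the contragredient
functor and under direct sums of two, hence of any positive finite number of, objects. The full
subcategories of the category `M_sg` of modules (on which `L(0)` is semisimple) are among them,
since `M_sg` is a full subcategory of `GM_sg`. -/
structure IsAdmissible (S : StronglyGradedVertexAlgebra A V) (C : ModuleData.{u} V At → Prop) :
    Prop where
  le : ∀ W, C W → W.IsGeneralizedModule S
  contragredient : ∀ W (hW : C W), C (W.contragredient S (le W hW))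
  directSum : ∀ M N, C M → C N → ∃ (D : ModuleData.{u} V At) (ι₁ : M →ₗ[ℂ] D) (ι₂ : N →ₗ[ℂ] D),
    C D ∧ IsHom ι₁ ∧ IsHom ι₂ ∧ Function.Bijective (LinearMap.coprod ι₁ ι₂)

/-- `C` is closed under images: if `φ : M → N` is a map of generalized modules with `M` in `C`, and
the generalized module `P` is the image `φ(M)` (embedded in `N` by `ι`), then `P` is in `C`. -/
def ClosedUnderImages (S : StronglyGradedVertexAlgebra A V) (C : ModuleData.{u} V At → Prop) :
    Prop :=
  ∀ (M N P : ModuleData.{u} V At) (φ : M →ₗ[ℂ] N) (ι : P →ₗ[ℂ] N), C M →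
    N.IsGeneralizedModule S → P.IsGeneralizedModule S → IsHom φ → IsHom ι →
    Function.Injective ι → LinearMap.range ι = LinearMap.range φ → C P

end ModuleData

end LogTensor

end

open LogTensor LogTensor.ModuleData

/-! Pairing with the graded dual reverses arrows. A product `(W; I)` gives `I' : W' → (W₁ ⊗ W₂)^*`,
and for a module map `η : W₀ → W` the condition `η̄ ∘ I₀ = I` says exactly that `I' = I₀' ∘ η'`,
with `η'` the transpose of `η`. So a product is universal when every `I'` factors uniquely through
`I₀'`. The inclusion of the union of all the images `I'(W')` has this property almost by definition;
part (1) is the dual form of this remark, and part (2) reads it backwards.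

The duality rests on the finite dimension of the spaces `W_[n]^(β)`: elements of `W` are separated
by `W'` (`contra_separates`), and every element of `W''` is an evaluation (`exists_eval`), so a
module map `K : W' → N` transposes to `N' → W`. For vertex operators it rests on the involution
`opp_opp`, which amounts to `e^(-X) e^X = 1` for a multiple `X` of the locally nilpotent operator
`L(1)`.

The commutator formula and the `L(j)` relations make `I'` a module map (`isHom_primeMap`). In the
other direction, let `J` be the inclusion of the union. The `L(j)` relations for `J'` follow from
`J` commuting with `L(j)`, but the Jacobi identity is borrowed: each `x` equals `I'(f)` for some
actual intertwining map `I`, the whole of `I'(W')` lies in the union, hence `I' = J ∘ K` with `K` a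
module map, and testing `J'` at `x = K f` is testing `I` at `f` (`evalMap_intertwining`). The
transpose of `K` is the required `η` (`existsUnique_hom_of_evalMap`).

For (2), `I' = I₀' ∘ η'` puts every image inside that of `I₀'`, so the union is the single image
`I₀'(W₀')`. The module axioms descend along the surjection from `W₀'`; independence of the
`At`-grading holds because functionals of different degrees live on different parts of `W₁ ⊗ W₂`. -/

namespace LogTensor

/-! ### Projections of a graded vector space -/

section Gradings

variable {ι W X : Type*} [AddCommGroup W] [Module ℂ W] [AddCommGroup X] [Module ℂ X]
  {g : ι → Submodule ℂ W} {g' : ι → Submodule ℂ X}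

theorem IsGrading.le_of_forall (hg : IsGrading g) {Q : Submodule ℂ W} (h : ∀ i, g i ≤ Q) (x : W) :
    x ∈ Q :=
  (hg.2 ▸ iSup_le h : ⊤ ≤ Q) trivial

theorem IsGrading.hom_ext (hg : IsGrading g) {f f' : W →ₗ[ℂ] X}
    (h : ∀ i, ∀ x ∈ g i, f x = f' x) : f = f' :=
  LinearMap.ext (hg.le_of_forall (Q := LinearMap.eqLocus f f') h)

theorem gradedProj_mem (hg : IsGrading g) (i : ι) (x : W) : gradedProj hg i x ∈ g i :=
  Submodule.coe_mem _

open Classical in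
theorem gradedProj_apply_eq (hg : IsGrading g) {i j : ι} {x : W} (hx : x ∈ g i) :
    gradedProj hg j x = if i = j then x else 0 := by
  have hi : Function.Bijective (DirectSum.coeLinearMap g) :=
    DirectSum.isInternal_submodule_of_iSupIndep_of_iSup_eq_top hg.1 hg.2
  have h : (LinearEquiv.ofBijective (DirectSum.coeLinearMap g) hi).symm x
      = DirectSum.lof ℂ ι (fun j => g j) i ⟨x, hx⟩ := by
    rw [LinearEquiv.symm_apply_eq, LinearEquiv.ofBijective_apply, DirectSum.coeLinearMap_lof]
  have h' : gradedProj hg j x = ((DirectSum.component ℂ ι (fun j => g j) j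
      ((LinearEquiv.ofBijective (DirectSum.coeLinearMap g) hi).symm x) : g j) : W) := rfl
  rw [h', h, DirectSum.component.of]
  split_ifs with hij
  · subst hij; rfl
  · rfl

theorem gradedProj_of_mem (hg : IsGrading g) {i : ι} {x : W} (hx : x ∈ g i) :
    gradedProj hg i x = x := by
  classical
  rw [gradedProj_apply_eq hg hx, if_pos rfl]

theorem gradedProj_of_ne (hg : IsGrading g) {i j : ι} {x : W} (hx : x ∈ g i) (hij : i ≠ j) :
    gradedProj hg j x = 0 := by
  classical
  rw [gradedProj_apply_eq hg hx, if_neg hij]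

theorem gradedProj_finite (hg : IsGrading g) (x : W) :
    {i | gradedProj hg i x ≠ 0}.Finite := by
  have hx : x ∈ iSup g := hg.2 ▸ trivial
  induction hx using Submodule.iSup_induction' with
  | mem i x hx =>
    refine (Set.finite_singleton i).subset fun j hj => ?_
    by_contra hij
    exact hj (gradedProj_of_ne hg hx (Ne.symm hij))
  | zero => simp
  | add x y _ _ hx hy =>
    refine (hx.union hy).subset fun j hj => ?_
    by_contra hij
    simp only [Set.mem_union, Set.mem_ofPred_eq, not_or, not_not] at hij
    exact hj (by rw [map_add, hij.1, hij.2, add_zero])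

theorem finsum_gradedProj (hg : IsGrading g) (x : W) : ∑ᶠ i, gradedProj hg i x = x := by
  have hx : x ∈ iSup g := hg.2 ▸ trivial
  induction hx using Submodule.iSup_induction' with
  | mem i x hx =>
    rw [finsum_eq_single _ i fun j hj => gradedProj_of_ne hg hx (Ne.symm hj),
      gradedProj_of_mem hg hx]
  | zero => simp
  | add x y _ _ hx hy =>
    simp only [map_add]
    rw [finsum_add_distrib (gradedProj_finite hg x) (gradedProj_finite hg y), hx, hy]

theorem map_eq_finsum_gradedProj (hg : IsGrading g) (f : W →ₗ[ℂ] X) (x : W) :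
    f x = ∑ᶠ i, f (gradedProj hg i x) := by
  conv_lhs => rw [← finsum_gradedProj hg x]
  exact f.toAddMonoidHom.map_finsum (gradedProj_finite hg x)

theorem map_gradedProj (hg : IsGrading g) (hg' : IsGrading g') (f : W →ₗ[ℂ] X)
    (hf : ∀ i, ∀ x ∈ g i, f x ∈ g' i) (i : ι) (x : W) :
    f (gradedProj hg i x) = gradedProj hg' i (f x) := by
  classical
  refine LinearMap.congr_fun (hg.hom_ext (f := f ∘ₗ gradedProj hg i)
    (f' := gradedProj hg' i ∘ₗ f) fun j y hy => ?_) x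
  rw [LinearMap.comp_apply, LinearMap.comp_apply, gradedProj_apply_eq hg hy,
    gradedProj_apply_eq hg' (hf j y hy)]
  split_ifs <;> simp

/-- Homogeneity with respect to a grading is detected by the vanishing of the other components. -/
theorem mem_of_gradedProj_eq_zero (hg : IsGrading g) {i : ι} {x : W}
    (h : ∀ j, j ≠ i → gradedProj hg j x = 0) : x ∈ g i := by
  rw [← finsum_gradedProj hg x, finsum_eq_single _ i h]
  exact gradedProj_mem hg i x

end Gradings
end LogTensor

/-! ### The double grading by `At` and by weight -/

namespace LogTensor.ModuleData

theorem IsHom.map_wt {At V : Type*} [AddCommGroup V] [Module ℂ V]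
    {M N : ModuleData.{u} V At} {f : M →ₗ[ℂ] N} (hf : IsHom f) (n : ℂ) (x : M)
    (hx : x ∈ M.wt n) : f x ∈ N.wt n := by
  unfold wt at hx ⊢
  rw [Module.End.mem_maxGenEigenspace] at hx ⊢
  obtain ⟨k, hk⟩ := hx
  refine ⟨k, ?_⟩
  have key : ∀ (k : ℕ) (x : M), ((N.ops.L0 - n • 1) ^ k) (f x) = f (((M.ops.L0 - n • 1) ^ k) x) := by
    intro k
    induction k with
    | zero => intro x; simp
    | succ k ih =>
      intro x
      rw [pow_succ, pow_succ, Module.End.mul_apply, Module.End.mul_apply, ← ih]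
      simp [hf.map_L0]
  rw [key, hk, map_zero]

/-- The doubly homogeneous subspace `W_[n]^(β)`. -/
def homog {At V : Type*} [AddCommGroup V] [Module ℂ V] (W : ModuleData.{u} V At)
    (p : At × ℂ) : Submodule ℂ W :=
  W.gr p.1 ⊓ W.wt p.2

theorem IsHom.map_homog {At V : Type*} [AddCommGroup V] [Module ℂ V]
    {M N : ModuleData.{u} V At} {f : M →ₗ[ℂ] N} (hf : IsHom f) (p : At × ℂ)
    (x : M) (hx : x ∈ M.homog p) : f x ∈ N.homog p :=
  ⟨hf.map_gr _ _ hx.1, hf.map_wt _ _ hx.2⟩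

theorem IsHom.comp_mem_contraSpace {At V : Type*} [AddCommGroup V] [Module ℂ V]
    {M N : ModuleData.{u} V At} {f : M →ₗ[ℂ] N} (hf : IsHom f)
    {φ : Module.Dual ℂ N} (hφ : φ ∈ N.contraSpace) : φ ∘ₗ f ∈ M.contraSpace := by
  refine Set.Finite.subset hφ ?_
  rintro p ⟨w, hw, h⟩
  exact ⟨f w, hf.map_homog p w hw, h⟩

section Homogeneous

variable {At : Type*} [AddCommGroup At] {A : AddSubgroup At}
  {V : Type*} [AddCommGroup V] [Module ℂ V] {S : StronglyGradedVertexAlgebra A V}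

variable {W : ModuleData.{u} V At}

theorem projWt_mem_gr (hW : W.IsGeneralizedModule S) {β : At} {x : W} (hx : x ∈ W.gr β) (n : ℂ) :
    gradedProj hW.wt_grading n x ∈ W.gr β := by
  classical
  have h : W.gr β ≤ (W.gr β).comap (gradedProj hW.wt_grading n) := by
    conv_lhs => rw [hW.compatible β]
    refine iSup_le fun m y hy => ?_
    rw [Submodule.mem_comap, gradedProj_apply_eq hW.wt_grading hy.2]
    split_ifs
    · exact hy.1
    · exact Submodule.zero_mem _
  exact h hx

/-- Compatibility of the two gradings gives spanning. For independence, the composite of the degree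
projection and the weight projection attached to `p` fixes `W.homog p` and kills every other piece.
-/
theorem homog_grading (hW : W.IsGeneralizedModule S) : IsGrading W.homog := by
  constructor
  · intro p
    rw [Submodule.disjoint_def]
    intro x hx hx'
    have h0 : ⨆ q, ⨆ (_ : q ≠ p), W.homog q
        ≤ LinearMap.ker (gradedProj hW.wt_grading p.2 ∘ₗ gradedProj hW.gr_grading p.1) := by
      refine iSup₂_le fun q hq y hy => ?_
      rw [LinearMap.mem_ker, LinearMap.comp_apply]
      by_cases h1 : q.1 = p.1
      · rw [gradedProj_of_mem hW.gr_grading (h1 ▸ hy.1)]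
        exact gradedProj_of_ne _ hy.2 fun h2 => hq (Prod.ext h1 h2)
      · rw [gradedProj_of_ne hW.gr_grading hy.1 h1, map_zero]
    have h1 := h0 hx'
    rw [LinearMap.mem_ker, LinearMap.comp_apply, gradedProj_of_mem hW.gr_grading hx.1,
      gradedProj_of_mem hW.wt_grading hx.2] at h1
    exact h1
  · rw [eq_top_iff]
    intro x _
    refine hW.gr_grading.le_of_forall (fun β => ?_) x
    rw [hW.compatible β]
    exact iSup_le fun n => le_iSup W.homog (β, n)

theorem projHomog_eq (hW : W.IsGeneralizedModule S) (p : At × ℂ) (x : W) : gradedProj (homog_grading hW) p x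
    = gradedProj hW.wt_grading p.2 (gradedProj hW.gr_grading p.1 x) := by
  classical
  refine LinearMap.congr_fun ((homog_grading hW).hom_ext
    (f' := gradedProj hW.wt_grading p.2 ∘ₗ gradedProj hW.gr_grading p.1) fun q y hy => ?_) x
  rw [LinearMap.comp_apply, gradedProj_apply_eq _ hy, gradedProj_apply_eq hW.gr_grading hy.1,
    apply_ite (gradedProj hW.wt_grading p.2), gradedProj_apply_eq hW.wt_grading hy.2, map_zero,
    ← ite_and]
  simp only [Prod.ext_iff]

theorem projHomog_projWt (hW : W.IsGeneralizedModule S) (p : At × ℂ) (n : ℂ) (x : W)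
    [Decidable (p.2 = n)] :
    gradedProj (homog_grading hW) p (gradedProj hW.wt_grading n x)
      = if p.2 = n then gradedProj (homog_grading hW) p x else 0 := by
  classical
  have h1 : gradedProj (homog_grading hW) p ∘ₗ gradedProj hW.wt_grading n
      = if p.2 = n then gradedProj (homog_grading hW) p else 0 := by
    refine (homog_grading hW).hom_ext fun q y hy => ?_
    rw [LinearMap.comp_apply, gradedProj_apply_eq hW.wt_grading hy.2]
    by_cases hq : q = p
    · subst hq; split_ifs <;> simp
    · split_ifs <;> simp [gradedProj_of_ne (homog_grading hW) hy hq]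
  have h2 := LinearMap.congr_fun h1 x
  rw [LinearMap.comp_apply] at h2
  rw [h2]
  split_ifs <;> rfl

theorem projHomog_of_mem_wt (hW : W.IsGeneralizedModule S) {n : ℂ} {x : W} (hx : x ∈ W.wt n)
    {p : At × ℂ} (hp : p.2 ≠ n) :
    gradedProj (homog_grading hW) p x = 0 := by
  classical
  rw [← gradedProj_of_mem hW.wt_grading hx, projHomog_projWt hW, if_neg hp]

theorem projHomog_of_mem_gr (hW : W.IsGeneralizedModule S) {β : At} {x : W} (hx : x ∈ W.gr β)
    {p : At × ℂ} (hp : p.1 ≠ β) :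
    gradedProj (homog_grading hW) p x = 0 := by
  rw [projHomog_eq hW, gradedProj_of_ne hW.gr_grading hx (Ne.symm hp), map_zero]

/-- This makes the pairing of `W'` with the completion of `W` a finite sum over weights. -/
theorem contra_wt_finite (hW : W.IsGeneralizedModule S) {f : Module.Dual ℂ W} (hf : f ∈ W.contraSpace) :
    {n | ∃ x ∈ W.wt n, f x ≠ 0}.Finite := by
  refine (Set.Finite.image Prod.snd hf).subset ?_
  rintro n ⟨x, hx, h⟩
  rw [map_eq_finsum_gradedProj (homog_grading hW)] at h
  obtain ⟨p, hp⟩ : ∃ p, f (gradedProj (homog_grading hW) p x) ≠ 0 := by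
    by_contra! h0
    exact h (finsum_eq_zero_of_forall_eq_zero h0)
  refine ⟨p, ⟨_, gradedProj_mem (homog_grading hW) p x, hp⟩, ?_⟩
  by_contra hn
  exact hp (by rw [projHomog_of_mem_wt hW hx hn, map_zero])

theorem pow_shift_homog (hW : W.IsGeneralizedModule S) (p : At × ℂ) (k : ℕ) (x : W)
    (hx : x ∈ W.homog p) (n : ℂ) :
    ((W.ops.L0 - n • 1) ^ k) x ∈ W.homog p := by
  induction k generalizing x with
  | zero => simpa using hx
  | succ k ih =>
    rw [pow_succ, Module.End.mul_apply]
    refine ih _ ?_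
    rw [LinearMap.sub_apply]
    refine Submodule.sub_mem _ ⟨(hW.L_mem _ _ hx.1).2.1, ?_⟩
      (Submodule.smul_mem _ _ hx)
    have h := W.shift_wt W.ops.L0 0 (by simp) p.2 x hx.2
    rwa [add_zero] at h

/-- Finite dimension gives one exponent for the whole piece: take the maximum over a finite spanning
set. Uniformity is what shows that a functional supported on `W.homog p` is a generalized
eigenvector of the transposed `L(0)`. -/
theorem exists_pow_shift_eq_zero (hW : W.IsGeneralizedModule S) (p : At × ℂ) :
    ∃ k : ℕ, ∀ x ∈ W.homog p, ((W.ops.L0 - p.2 • 1) ^ k) x = 0 := by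
  have := hW.finite_dim p.1 p.2
  obtain ⟨s, hs⟩ := Module.Finite.iff_fg.mp this
  have hs' : ∀ x ∈ s, ∃ k : ℕ, ((W.ops.L0 - p.2 • 1) ^ k) x = 0 := by
    intro x hx
    have hx' : x ∈ W.homog p := hs.le (Submodule.subset_span hx)
    exact (Module.End.mem_maxGenEigenspace _ _ _).mp hx'.2
  choose! k hk using hs'
  refine ⟨s.sup k, fun x hx => ?_⟩
  have hle : W.homog p ≤ LinearMap.ker ((W.ops.L0 - p.2 • 1) ^ s.sup k) := by
    rw [homog, ← hs, Submodule.span_le]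
    intro y hy
    obtain ⟨d, hd⟩ := Nat.exists_eq_add_of_le (Finset.le_sup (f := k) hy)
    rw [SetLike.mem_coe, LinearMap.mem_ker, hd, add_comm, pow_add, Module.End.mul_apply, hk y hy,
      map_zero]
  exact hle hx

end Homogeneous

/-! ### The contragredient and the double dual -/

section Contragredient

variable {At : Type*} [AddCommGroup At] {A : AddSubgroup At}
  {V : Type*} [AddCommGroup V] [Module ℂ V] {S : StronglyGradedVertexAlgebra A V}
  {W : ModuleData.{u} V At} (hW : W.IsGeneralizedModule S)

/-- An element of `W'` as a functional on `W`. -/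
noncomputable def contraCoe : W.contragredient S hW →ₗ[ℂ] Module.Dual ℂ W := W.contraSpace.subtype

/-- A functional in the graded dual as an element of `W'`. -/
def contraMk (f : Module.Dual ℂ W) (hf : f ∈ W.contraSpace) : W.contragredient S hW := ⟨f, hf⟩

theorem contraCoe_mem (f : W.contragredient S hW) : contraCoe hW f ∈ W.contraSpace := f.2

theorem contraCoe_mk (f : Module.Dual ℂ W) (hf : f ∈ W.contraSpace) :
    contraCoe hW (contraMk hW f hf) = f := rfl

theorem contraCoe_injective : Function.Injective (contraCoe hW) := W.contraSpace.injective_subtype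

theorem contraCoe_Y (v : V) (n : ℤ) (f : W.contragredient S hW) :
    contraCoe hW ((W.contragredient S hW).ops.Y v n f) = contraCoe hW f ∘ₗ S.opp W.ops.Y v n := rfl

theorem contraCoe_Ln1 (f : W.contragredient S hW) :
    contraCoe hW ((W.contragredient S hW).ops.Ln1 f) = contraCoe hW f ∘ₗ W.ops.L1 := rfl

theorem contraCoe_L0 (f : W.contragredient S hW) :
    contraCoe hW ((W.contragredient S hW).ops.L0 f) = contraCoe hW f ∘ₗ W.ops.L0 := rfl

theorem contraCoe_L1 (f : W.contragredient S hW) :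
    contraCoe hW ((W.contragredient S hW).ops.L1 f) = contraCoe hW f ∘ₗ W.ops.Ln1 := rfl

theorem mem_contra_gr {β : At} {f : W.contragredient S hW} :
    f ∈ (W.contragredient S hW).gr β ↔ ∀ γ, γ ≠ -β → ∀ x ∈ W.gr γ, contraCoe hW f x = 0 := by
  have h : ∀ g : W.contraSpace,
      g ∈ (⨅ γ ∈ {γ | γ ≠ -β}, (W.gr γ).dualAnnihilator).comap W.contraSpace.subtype ↔
        ∀ γ, γ ≠ -β → ∀ x ∈ W.gr γ, g.1 x = 0 := by
    intro g
    simp [Submodule.mem_iInf, Submodule.mem_dualAnnihilator]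
  exact h f

theorem mem_contra_wt {n : ℂ} {f : W.contragredient S hW} :
    f ∈ (W.contragredient S hW).wt n ↔
      ∃ k : ℕ, contraCoe hW f ∘ₗ ((W.ops.L0 - n • 1) ^ k) = 0 := by
  have key : ∀ (k : ℕ) (f : W.contragredient S hW),
      contraCoe hW ((((W.contragredient S hW).ops.L0 - n • 1) ^ k) f)
        = contraCoe hW f ∘ₗ ((W.ops.L0 - n • 1) ^ k) := by
    intro k
    induction k with
    | zero => intro f; rfl
    | succ k ih =>
      intro f
      rw [pow_succ, Module.End.mul_apply, ih, LinearMap.sub_apply, map_sub, contraCoe_L0, pow_succ',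
        Module.End.mul_eq_comp, ← LinearMap.comp_assoc, LinearMap.comp_sub,
        LinearMap.smul_apply, Module.End.one_apply, map_smul, LinearMap.comp_smul,
        Module.End.one_eq_id, LinearMap.comp_id]
  unfold wt
  rw [Module.End.mem_maxGenEigenspace]
  refine exists_congr fun k => ?_
  rw [← key, ← map_zero (contraCoe hW), (contraCoe_injective hW).eq_iff]

theorem mem_contra_homog (p : At × ℂ) (f : W.contragredient S hW)
    (hf : ∀ q, q ≠ p → ∀ x ∈ W.homog q, contraCoe hW f x = 0) :
    f ∈ (W.contragredient S hW).homog (-p.1, p.2) := by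
  refine ⟨(mem_contra_gr hW).mpr ?_, (mem_contra_wt hW).mpr ?_⟩
  · change ∀ γ, γ ≠ - -p.1 → _
    intro γ hγ x hx
    rw [neg_neg] at hγ
    rw [map_eq_finsum_gradedProj (homog_grading hW)]
    refine finsum_eq_zero_of_forall_eq_zero fun q => ?_
    by_cases hq : q = p
    · rw [projHomog_of_mem_gr hW hx (hq ▸ hγ.symm), map_zero]
    · exact hf q hq _ (gradedProj_mem _ q x)
  · obtain ⟨k, hk⟩ := exists_pow_shift_eq_zero hW p
    refine ⟨k, (homog_grading hW).hom_ext fun q x hx => ?_⟩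
    rw [LinearMap.comp_apply, LinearMap.zero_apply]
    by_cases hq : q = p
    · rw [hk x (hq ▸ hx), map_zero]
    · exact hf q hq _ (pow_shift_homog hW q k x hx _)

theorem comp_projHomog_mem (p : At × ℂ) (φ : Module.Dual ℂ W) :
    φ ∘ₗ gradedProj (homog_grading hW) p ∈ W.contraSpace := by
  refine (Set.finite_singleton p).subset ?_
  rintro q ⟨x, hx, h⟩
  by_contra hq
  exact h (by rw [LinearMap.comp_apply, gradedProj_of_ne (homog_grading hW) hx hq, map_zero])

/-- The functional `φ` cut down to the component `W_[n]^(β)`, `p = (β, n)`. -/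
noncomputable def contraPart (p : At × ℂ) : Module.Dual ℂ W →ₗ[ℂ] W.contragredient S hW :=
  LinearMap.codRestrict W.contraSpace
    (Module.Dual.transpose (R := ℂ) (gradedProj (homog_grading hW) p))
    (comp_projHomog_mem hW p)

theorem contraCoe_part (p : At × ℂ) (φ : Module.Dual ℂ W) (x : W) :
    contraCoe hW (contraPart hW p φ) x = φ (gradedProj (homog_grading hW) p x) := rfl

theorem contraPart_mem (p : At × ℂ) (φ : Module.Dual ℂ W) :
    contraPart hW p φ ∈ (W.contragredient S hW).homog (-p.1, p.2) := by
  refine mem_contra_homog hW p _ fun q hq x hx => ?_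
  rw [contraCoe_part, gradedProj_of_ne (homog_grading hW) hx hq, map_zero]

/-- A functional in `W'` is the finite sum of its restrictions to the homogeneous pieces. The
argument does not presuppose that `W'` satisfies the module axioms. -/
theorem contra_induction {Q : Submodule ℂ (W.contragredient S hW)}
    (h : ∀ p φ, contraPart hW p φ ∈ Q) (f : W.contragredient S hW) : f ∈ Q := by
  have hf : {p | contraPart hW p (contraCoe hW f) ≠ 0}.Finite := by
    refine (contraCoe_mem hW f).subset fun p hp => ?_
    by_contra h0
    refine hp (contraCoe_injective hW (LinearMap.ext fun x => ?_))
    rw [contraCoe_part, map_zero, LinearMap.zero_apply]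
    by_contra h1
    exact h0 ⟨_, gradedProj_mem (homog_grading hW) p x, h1⟩
  have hsum : f = ∑ᶠ p, contraPart hW p (contraCoe hW f) := by
    refine contraCoe_injective hW (LinearMap.ext fun x => ?_)
    have h1 := ((LinearMap.applyₗ x ∘ₗ contraCoe hW).toAddMonoidHom).map_finsum hf
    refine Eq.trans ?_ h1.symm
    exact map_eq_finsum_gradedProj (homog_grading hW) _ x
  rw [hsum]
  exact finsum_induction (· ∈ Q) Q.zero_mem (fun _ _ => Q.add_mem) fun p => h p _

theorem contra_hom_ext {X : Type*} [AddCommGroup X] [Module ℂ X]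
    {F G : W.contragredient S hW →ₗ[ℂ] X}
    (h : ∀ p φ, F (contraPart hW p φ) = G (contraPart hW p φ)) : F = G :=
  LinearMap.ext (contra_induction hW (Q := LinearMap.eqLocus F G) h)

/-- `L'(0)` is the transpose of `L(0)`, so weight `n` pairs only with weight `n`, and the weight
projections are transposes of each other. -/
theorem contraCoe_projWt (hW' : (W.contragredient S hW).IsGeneralizedModule S) (n : ℂ)
    (f : W.contragredient S hW) (x : W) :
    contraCoe hW (gradedProj hW'.wt_grading n f) x
      = contraCoe hW f (gradedProj hW.wt_grading n x) := by
  classical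
  refine LinearMap.congr_fun (LinearMap.congr_fun (contra_hom_ext hW
    (F := contraCoe hW ∘ₗ gradedProj hW'.wt_grading n)
    (G := Module.Dual.transpose (R := ℂ) (gradedProj hW.wt_grading n) ∘ₗ contraCoe hW)
    fun p φ => LinearMap.ext fun x => ?_) f) x
  change contraCoe hW (gradedProj hW'.wt_grading n (contraPart hW p φ)) x
    = contraCoe hW (contraPart hW p φ) (gradedProj hW.wt_grading n x)
  rw [gradedProj_apply_eq hW'.wt_grading (contraPart_mem hW p φ).2, contraCoe_part,
    projHomog_projWt hW]
  split_ifs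
  · rfl
  · simp

theorem eq_zero_of_contra {w : W} (h : ∀ f : W.contragredient S hW, contraCoe hW f w = 0) :
    w = 0 := by
  rw [← finsum_gradedProj (homog_grading hW) w]
  refine finsum_eq_zero_of_forall_eq_zero fun p => ?_
  rw [← Module.forall_dual_apply_eq_zero_iff ℂ]
  intro φ
  exact h (contraPart hW p φ)

theorem contra_separates {w w' : W}
    (h : ∀ f : W.contragredient S hW, contraCoe hW f w = contraCoe hW f w') : w = w' := by
  rw [← sub_eq_zero]
  refine eq_zero_of_contra hW fun f => ?_
  rw [map_sub, h, sub_self]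

/-- The components of `w` of degree `γ ≠ β` are detected by functionals supported in degree `γ`, and
these have degree `-γ` in `W'`. -/
theorem mem_gr_of_contra {β : At} {w : W}
    (h : ∀ γ, γ ≠ -β → ∀ f ∈ (W.contragredient S hW).gr γ, contraCoe hW f w = 0) : w ∈ W.gr β := by
  refine mem_of_gradedProj_eq_zero hW.gr_grading fun γ hγ => ?_
  rw [← finsum_gradedProj hW.wt_grading (gradedProj hW.gr_grading γ w)]
  refine finsum_eq_zero_of_forall_eq_zero fun n => ?_
  rw [← Module.forall_dual_apply_eq_zero_iff ℂ]
  intro φ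
  rw [← projHomog_eq hW (γ, n), ← contraCoe_part hW]
  exact h (-γ) (fun h => hγ (neg_injective h)) _ (contraPart_mem hW (γ, n) φ).1

/-- Every element of the double contragredient is the evaluation at an element of `W`. -/
theorem exists_eval {g : Module.Dual ℂ (W.contragredient S hW)}
    (hg : g ∈ (W.contragredient S hW).contraSpace) :
    ∃ w, ∀ f, g f = contraCoe hW f w := by
  have hfin : ∀ p, Module.Finite ℂ (W.homog p) := fun p => hW.finite_dim p.1 p.2
  have hmem := homog_grading hW
  -- Reflexivity of the finite-dimensional piece `W.homog p` represents `g` there by a vector `w p`.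
  have hex : ∀ p, ∃ w ∈ W.homog p, ∀ φ, g (contraPart hW p φ) = φ w := by
    intro p
    let P : W →ₗ[ℂ] W.homog p := LinearMap.codRestrict _ (gradedProj hmem p) (gradedProj_mem hmem p)
    let G : Module.Dual ℂ (Module.Dual ℂ (W.homog p)) :=
      g ∘ₗ contraPart hW p ∘ₗ Module.Dual.transpose (R := ℂ) P
    refine ⟨(Module.evalEquiv ℂ (W.homog p)).symm G, Submodule.coe_mem _, fun φ => ?_⟩
    have h1 : G (φ ∘ₗ (W.homog p).subtype) = g (contraPart hW p φ) := by
      change g (contraPart hW p ((φ ∘ₗ (W.homog p).subtype) ∘ₗ P)) = _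
      congr 1
      refine contraCoe_injective hW (LinearMap.ext fun x => ?_)
      rw [contraCoe_part, contraCoe_part]
      change φ (gradedProj hmem p (gradedProj hmem p x)) = _
      rw [gradedProj_of_mem hmem (gradedProj_mem hmem p x)]
    rw [← h1]
    have h2 := (Module.evalEquiv ℂ (W.homog p)).apply_symm_apply G
    conv_lhs => rw [← h2]
    rfl
  choose w hw hgw using hex
  -- The dual of the piece `(β, n)` sits in bidegree `(-β, n)`, and `g` is nonzero on only finitely
  -- many bidegrees of `W'`; hence the vectors `w p` can be summed.
  have hsupp : (Function.support w).Finite := by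
    have hinj : Function.Injective (fun p : At × ℂ => (-p.1, p.2)) := by
      rintro ⟨x, y⟩ ⟨x', y'⟩ h
      simpa using h
    refine (Set.Finite.preimage hinj.injOn hg).subset fun p hp => ?_
    by_contra h0
    refine hp ((Module.forall_dual_apply_eq_zero_iff ℂ _).mp fun φ => ?_)
    rw [← hgw]
    by_contra h1
    exact h0 ⟨_, contraPart_mem hW p φ, h1⟩
  refine ⟨∑ᶠ p, w p, fun f => LinearMap.congr_fun (contra_hom_ext hW
    (G := LinearMap.applyₗ (∑ᶠ p, w p) ∘ₗ contraCoe hW) fun p φ => ?_) f⟩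
  change _ = contraCoe hW (contraPart hW p φ) (∑ᶠ p, w p)
  rw [hgw, contraCoe_part]
  congr 1
  have h3 := (gradedProj hmem p).toAddMonoidHom.map_finsum hsupp
  refine Eq.trans ?_ h3.symm
  change _ = ∑ᶠ q, gradedProj hmem p (w q)
  rw [finsum_eq_single _ p fun q hq => gradedProj_of_ne hmem (hw q) hq]
  exact (gradedProj_of_mem hmem (hw p)).symm

/-- Since `W'` separates points, the representing vectors are unique and so depend linearly on `x`.
Maps into `W` are built this way from maps into `W''`. -/
theorem exists_linear_eval {X : Type*} [AddCommGroup X] [Module ℂ X]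
    (F : X →ₗ[ℂ] Module.Dual ℂ (W.contragredient S hW))
    (hF : ∀ x, F x ∈ (W.contragredient S hW).contraSpace) :
    ∃ η : X →ₗ[ℂ] W, ∀ x f, contraCoe hW f (η x) = F x f := by
  choose η hη using fun x => exists_eval hW (hF x)
  refine ⟨{ toFun := η, map_add' := ?_, map_smul' := ?_ }, fun x f => (hη x f).symm⟩
  · intro x y
    refine contra_separates hW fun f => ?_
    rw [map_add, ← hη, ← hη, ← hη, map_add, LinearMap.add_apply]
  · intro a x
    refine contra_separates hW fun f => ?_
    rw [map_smul, ← hη, ← hη, map_smul, LinearMap.smul_apply]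
    rfl

end Contragredient

end LogTensor.ModuleData

namespace LogTensor

/-! ### Opposite vertex operators -/

section Opposite

variable {At : Type*} [AddCommGroup At] {A : AddSubgroup At}
  {V : Type*} [AddCommGroup V] [Module ℂ V] (S : StronglyGradedVertexAlgebra A V)
  {U X : Type*} [AddCommGroup U] [Module ℂ U] [AddCommGroup X] [Module ℂ X]

theorem L1_mem_wt {h : ℤ} {v : V} (hv : v ∈ Module.End.eigenspace S.L0 (h : ℂ)) :
    S.L1 v ∈ Module.End.eigenspace S.L0 ((h - 1 : ℤ) : ℂ) := by
  rw [Module.End.mem_eigenspace_iff] at hv ⊢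
  have h1 := LinearMap.congr_fun S.action.sl2_zero_pos v
  simp only [LinearMap.sub_apply, Module.End.mul_apply, LinearMap.neg_apply, hv, map_smul] at h1
  rw [sub_eq_iff_eq_add.mp h1]
  push_cast
  rw [sub_smul, one_smul]
  abel

theorem L1_pow_mem_wt {h : ℤ} {v : V} (hv : v ∈ Module.End.eigenspace S.L0 (h : ℂ)) (m : ℕ) :
    (S.L1 ^ m) v ∈ Module.End.eigenspace S.L0 ((h - m : ℤ) : ℂ) := by
  induction m with
  | zero => simpa using hv
  | succ m ih =>
    rw [pow_succ', Module.End.mul_apply]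
    have := L1_mem_wt S ih
    rwa [show h - ((m + 1 : ℕ) : ℤ) = h - m - 1 by push_cast; ring]

theorem L1_pow_mem_gr {α : A} {v : V} (hv : v ∈ S.gr α) (m : ℕ) : (S.L1 ^ m) v ∈ S.gr α := by
  induction m with
  | zero => simpa using hv
  | succ m ih =>
    rw [pow_succ', Module.End.mul_apply]
    exact (S.L_mem α _ ih).2.2

/-- `L(1)` is locally nilpotent on a strongly graded vertex algebra. -/
theorem L1_locally_nilpotent (v : V) : ∃ M : ℕ, ∀ m, M ≤ m → (S.L1 ^ m) v = 0 := by
  have h : ∀ α, S.gr α ≤ S.L1.maxGenEigenspace 0 := by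
    intro α
    rw [S.compatible α]
    refine iSup_le fun h v hv => ?_
    obtain ⟨N, hN⟩ := S.wt_truncation α
    rw [Module.End.mem_maxGenEigenspace]
    -- Each application of `L(1)` lowers the weight by one and keeps the degree `α`; this many steps
    -- lead below the bound `N`, where the homogeneous space vanishes.
    refine ⟨(h - N + 1).toNat, ?_⟩
    rw [zero_smul, sub_zero]
    have h1 := Submodule.mem_inf.mpr
      ⟨L1_pow_mem_gr S hv.1 (h - N + 1).toNat, L1_pow_mem_wt S hv.2 (h - N + 1).toNat⟩
    rw [hN _ (by omega)] at h1
    exact (Submodule.mem_bot ℂ).mp h1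
  have hv := S.gr_grading.le_of_forall h v
  rw [Module.End.mem_maxGenEigenspace] at hv
  obtain ⟨k, hk⟩ := hv
  rw [zero_smul, sub_zero] at hk
  refine ⟨k, fun m hm => ?_⟩
  obtain ⟨d, rfl⟩ := Nat.exists_eq_add_of_le hm
  rw [add_comm, pow_add, Module.End.mul_apply, hk, map_zero]

theorem opp_inner_finite {Z : V → ℤ → U} (hZ : ∀ k, Z 0 k = 0) (v : V) (c : ℕ → ℂ) (k : ℕ → ℤ) :
    (Function.support fun m : ℕ => c m • Z ((S.L1 ^ m) v) (k m)).Finite := by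
  obtain ⟨M, hM⟩ := L1_locally_nilpotent S v
  refine (Set.finite_Iio M).subset fun m hm => ?_
  by_contra h
  exact hm (by simp only [hM m (not_lt.mp h), hZ, smul_zero])

theorem opp_outer_finite {Z : V → ℤ → U} (hZ : ∀ k, Z 0 k = 0) (v : V) (n : ℤ) :
    (Function.support fun h : ℤ => ∑ᶠ m : ℕ, ((-1 : ℂ) ^ h / (m.factorial : ℂ)) •
      Z ((S.L1 ^ m) (gradedProj S.wt_grading h v)) (-n - m - 2 + 2 * h)).Finite := by
  refine (gradedProj_finite S.wt_grading v).subset fun h hh => ?_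
  intro h0
  exact hh (by simp [h0, hZ])

/-- Linear maps commute with passing to the opposite family. -/
theorem map_opp (L : U →ₗ[ℂ] X) {Z : V → ℤ → U} (hZ : ∀ k, Z 0 k = 0) (v : V) (n : ℤ) :
    L (S.opp Z v n) = S.opp (fun v k => L (Z v k)) v n := by
  unfold StronglyGradedVertexAlgebra.opp
  refine (L.toAddMonoidHom.map_finsum (opp_outer_finite S hZ v n)).trans ?_
  refine finsum_congr fun h => ?_
  refine (L.toAddMonoidHom.map_finsum (opp_inner_finite S hZ _ _ _)).trans ?_
  exact finsum_congr fun m => map_smul L _ _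

/-- The opposite family depends only on the values at homogeneous vectors. -/
theorem opp_congr {Z Z' : V → ℤ → U}
    (h : ∀ h : ℤ, ∀ v ∈ Module.End.eigenspace S.L0 (h : ℂ), ∀ k, Z v k = Z' v k) (v : V) (n : ℤ) :
    S.opp Z v n = S.opp Z' v n :=
  finsum_congr fun l => finsum_congr fun m => by
    rw [h _ _ (L1_pow_mem_wt S (gradedProj_mem S.wt_grading l v) m)]

theorem opp_of_mem {Z : V → ℤ → U} (hZ : ∀ k, Z 0 k = 0) {h : ℤ} {v : V}
    (hv : v ∈ Module.End.eigenspace S.L0 (h : ℂ)) (n : ℤ) :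
    S.opp Z v n = ∑ᶠ m : ℕ, ((-1 : ℂ) ^ h / (m.factorial : ℂ)) •
      Z ((S.L1 ^ m) v) (-n - m - 2 + 2 * h) := by
  have hv' : v ∈ (fun n : ℤ => Module.End.eigenspace S.L0 (n : ℂ)) h := hv
  unfold StronglyGradedVertexAlgebra.opp
  rw [finsum_eq_single _ h]
  · rw [gradedProj_of_mem S.wt_grading hv']
  · intro l hl
    simp [gradedProj_of_ne S.wt_grading hv' hl.symm, hZ]

theorem opp_zero {Z : V → ℤ → U} (hZ : ∀ k, Z 0 k = 0) (n : ℤ) : S.opp Z 0 n = 0 := by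
  unfold StronglyGradedVertexAlgebra.opp
  simp [hZ]

/-- This is `e^(-X) e^X = 1` truncated at order `M`: on the diagonal `m + j = k` the coefficients
add up to `∑ (-1)^m (k choose m) / k!`, which is zero unless `k = 0`. -/
theorem sum_exp_neg_exp (F : ℕ → U) (M : ℕ) (hM : 0 < M) (hF : ∀ k, M ≤ k → F k = 0) :
    ∑ m ∈ Finset.range M, ∑ j ∈ Finset.range M,
      ((-1 : ℂ) ^ m / ((m.factorial : ℂ) * j.factorial)) • F (m + j) = F 0 := by
  have h1 : ∀ m ∈ Finset.range M, ∑ j ∈ Finset.range M,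
      ((-1 : ℂ) ^ m / ((m.factorial : ℂ) * j.factorial)) • F (m + j)
      = ∑ j ∈ Finset.range (M - m), ((-1 : ℂ) ^ m / ((m.factorial : ℂ) * j.factorial)) • F (m + j) := by
    intro m _
    symm
    refine Finset.sum_subset (Finset.range_mono (Nat.sub_le _ _)) fun j _ hj => ?_
    rw [Finset.mem_range] at hj
    rw [hF _ (by omega), smul_zero]
  rw [Finset.sum_congr rfl h1,
    ← Finset.sum_range_diag_flip M fun m j =>
      ((-1 : ℂ) ^ m / ((m.factorial : ℂ) * j.factorial)) • F (m + j)]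
  have h2 : ∀ k ∈ Finset.range M, ∑ m ∈ Finset.range (k + 1),
      ((-1 : ℂ) ^ m / ((m.factorial : ℂ) * (k - m).factorial)) • F (m + (k - m))
      = if k = 0 then F 0 else 0 := by
    intro k _
    have h3 : ∀ m ∈ Finset.range (k + 1),
        ((-1 : ℂ) ^ m / ((m.factorial : ℂ) * (k - m).factorial)) • F (m + (k - m))
        = (((((-1) ^ m * (k.choose m) : ℤ) : ℂ)) / (k.factorial : ℂ)) • F k := by
      intro m hm
      have hm' : m ≤ k := Nat.lt_succ_iff.mp (Finset.mem_range.mp hm)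
      rw [Nat.add_sub_cancel' hm']
      congr 1
      push_cast
      rw [Nat.cast_choose ℂ hm']
      have := Nat.cast_ne_zero (R := ℂ).mpr k.factorial_ne_zero
      field_simp
    rw [Finset.sum_congr rfl h3, ← Finset.sum_smul, ← Finset.sum_div, ← Int.cast_sum,
      Int.alternating_sum_range_choose]
    split_ifs with hk
    · subst hk; simp
    · simp
  rw [Finset.sum_congr rfl h2, Finset.sum_ite_eq' (Finset.range M) 0 fun _ => F 0,
    if_pos (Finset.mem_range.mpr hM)]

/-- Passing to the opposite family is an involution. -/
theorem opp_opp {Z : V → ℤ → U} (hadd : ∀ v w k, Z (v + w) k = Z v k + Z w k) (v : V) (n : ℤ) :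
    S.opp (S.opp Z) v n = Z v n := by
  have hZ : ∀ k, Z 0 k = 0 := fun k => by simpa using hadd 0 0 k
  have hO : ∀ k, S.opp Z 0 k = 0 := opp_zero S hZ
  have hom : ∀ (h : ℤ), ∀ v ∈ Module.End.eigenspace S.L0 (h : ℂ),
      ∑ᶠ m : ℕ, ((-1 : ℂ) ^ h / (m.factorial : ℂ)) •
        S.opp Z ((S.L1 ^ m) v) (-n - m - 2 + 2 * h) = Z v n := by
    intro h v hv
    obtain ⟨M, hM⟩ := L1_locally_nilpotent S v
    -- The bound `M + 1` is positive, so the surviving term `m = j = 0` always lies in the range.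
    have hM' : ∀ m, M + 1 ≤ m → (S.L1 ^ m) v = 0 := fun m hm => hM m (by omega)
    rw [finsum_eq_sum_of_support_subset (s := Finset.range (M + 1))]
    swap
    · intro m hm
      by_contra hlt
      rw [Finset.coe_range, Set.mem_Iio, not_lt] at hlt
      exact hm (by simp only [hM' m hlt, hO, smul_zero])
    -- As `L(1)^m v` has weight `h - m`, the two signs combine to `(-1)^h (-1)^(h-m) = (-1)^m`, and
    -- the two index reflections combine to `n - (m + j)`.
    have h1 : ∀ m ∈ Finset.range (M + 1), ((-1 : ℂ) ^ h / (m.factorial : ℂ)) •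
        S.opp Z ((S.L1 ^ m) v) (-n - m - 2 + 2 * h)
        = ∑ j ∈ Finset.range (M + 1), ((-1 : ℂ) ^ m / ((m.factorial : ℂ) * j.factorial)) •
          Z ((S.L1 ^ (m + j)) v) (n - (m + j : ℕ)) := by
      intro m _
      rw [opp_of_mem S hZ (L1_pow_mem_wt S hv m),
        finsum_eq_sum_of_support_subset (s := Finset.range (M + 1))]
      swap
      · intro j hj
        by_contra hlt
        rw [Finset.coe_range, Set.mem_Iio, not_lt] at hlt
        refine hj ?_
        simp only
        rw [← Module.End.mul_apply, ← pow_add, hM' _ (by omega), hZ, smul_zero]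
      rw [Finset.smul_sum]
      refine Finset.sum_congr rfl fun j _ => ?_
      rw [← Module.End.mul_apply, ← pow_add, smul_smul, add_comm j m]
      congr 1
      · have hne : (-1 : ℂ) ≠ 0 := by norm_num
        have hsq : (-1 : ℂ) ^ h * (-1) ^ h = 1 := by
          rw [← mul_zpow]; norm_num
        have hinv : ((-1 : ℂ) ^ m)⁻¹ = (-1) ^ m := by
          rw [← inv_pow]; norm_num
        rw [zpow_sub₀ hne, zpow_natCast, div_eq_mul_inv _ ((-1 : ℂ) ^ m), hinv, div_mul_div_comm,
          ← mul_assoc, hsq, one_mul]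
      · congr 1
        push_cast
        ring
    rw [Finset.sum_congr rfl h1,
      sum_exp_neg_exp (fun k => Z ((S.L1 ^ k) v) (n - k)) (M + 1) (Nat.succ_pos _)
        fun k hk => by simp only [hM' k hk, hZ]]
    simp
  let L : V →+ U := { toFun := fun v => Z v n, map_zero' := hZ n, map_add' := fun v w => hadd v w n }
  have h2 : Z v n = ∑ᶠ h, Z (gradedProj S.wt_grading h v) n := by
    conv_lhs => rw [← finsum_gradedProj S.wt_grading v]
    exact L.map_finsum (gradedProj_finite S.wt_grading v)
  rw [h2]
  conv_lhs => unfold StronglyGradedVertexAlgebra.opp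
  exact finsum_congr fun h => hom h _ (gradedProj_mem S.wt_grading h v)

end Opposite

namespace ModuleData

variable {At : Type*} [AddCommGroup At] {A : AddSubgroup At}
  {V : Type*} [AddCommGroup V] [Module ℂ V] {S : StronglyGradedVertexAlgebra A V}
  {W : ModuleData.{u} V At}

theorem IsGeneralizedModule.Y_zero (hW : W.IsGeneralizedModule S) (k : ℤ) : W.ops.Y 0 k = 0 := by
  simpa using hW.action.Y_smul 0 0 k

theorem IsGeneralizedModule.Y_mem_wt (hW : W.IsGeneralizedModule S) {h : ℤ} {v : V}
    (hv : v ∈ Module.End.eigenspace S.L0 (h : ℂ)) (k : ℤ) {n : ℂ} {w : W} (hw : w ∈ W.wt n) :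
    W.ops.Y v k w ∈ W.wt (n + (h - k - 1)) := by
  refine W.shift_wt _ _ ?_ n w hw
  rw [hW.action.bracket_zero, Module.End.mem_eigenspace_iff.mp hv, hW.action.Y_smul,
    hW.action.derivative, add_sub_cancel_right, ← add_smul]
  congr 1
  push_cast
  ring

/-- In the term with `L(1)^m v`, of weight `h - m`, the component index is `-k - m - 2 + 2h`, so the
weight shift is `k + 1 - h` whatever `m` is. -/
theorem IsGeneralizedModule.opp_Y_mem_wt (hW : W.IsGeneralizedModule S) {h : ℤ} {v : V}
    (hv : v ∈ Module.End.eigenspace S.L0 (h : ℂ)) (k : ℤ) {n : ℂ} {w : W} (hw : w ∈ W.wt n) :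
    S.opp W.ops.Y v k w ∈ W.wt (n + k + 1 - h) := by
  rw [opp_of_mem S hW.Y_zero hv]
  refine finsum_induction (fun T : Module.End ℂ W => T w ∈ W.wt (n + k + 1 - h))
    (Submodule.zero_mem _) (fun _ _ => Submodule.add_mem _) fun m => ?_
  refine Submodule.smul_mem _ _ ?_
  have h1 := hW.Y_mem_wt (L1_pow_mem_wt S hv m) (-k - m - 2 + 2 * h) hw
  convert h1 using 2
  push_cast
  ring

/-- A family of maps intertwining the vertex operators intertwines their opposites. -/
theorem opp_comm {M N : ModuleData.{u} V At} (hM : M.IsGeneralizedModule S)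
    (hN : N.IsGeneralizedModule S) {f : M →ₗ[ℂ] N}
    (hf : ∀ v n w, f (M.ops.Y v n w) = N.ops.Y v n (f w)) (v : V) (n : ℤ) (w : M) :
    f (S.opp M.ops.Y v n w) = S.opp N.ops.Y v n (f w) := by
  have h1 := map_opp S (f ∘ₗ LinearMap.applyₗ w) hM.Y_zero v n
  have h2 := map_opp S (LinearMap.applyₗ (f w) : Module.End ℂ N →ₗ[ℂ] N) hN.Y_zero v n
  refine h1.trans (Eq.trans ?_ h2.symm)
  exact opp_congr S (fun h v _ k => hf v k w) v n

/-- Transposition turns the opposite family on `W'` into the twofold opposite of the family on `W`,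
which is the original one by `opp_opp`. -/
theorem contraCoe_opp_Y (hW : W.IsGeneralizedModule S)
    (v : V) (n : ℤ) (f : W.contragredient S hW) :
    contraCoe hW (S.opp (W.contragredient S hW).ops.Y v n f) = contraCoe hW f ∘ₗ W.ops.Y v n := by
  have h0 : ∀ k, (W.contragredient S hW).ops.Y 0 k = 0 := by
    intro k
    refine LinearMap.ext fun f => contraCoe_injective hW ?_
    rw [contraCoe_Y, opp_zero S hW.Y_zero, LinearMap.comp_zero, LinearMap.zero_apply, map_zero]
  refine LinearMap.ext fun x => ?_
  have h1 := map_opp S (LinearMap.applyₗ x ∘ₗ contraCoe hW ∘ₗ LinearMap.applyₗ f) h0 v n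
  have h2 := map_opp S (contraCoe hW f ∘ₗ LinearMap.applyₗ x) (opp_zero S hW.Y_zero) v n
  refine h1.trans (h2.symm.trans ?_)
  rw [opp_opp S fun v w k => hW.action.Y_add v w k]
  rfl

end ModuleData
end LogTensor

/-! ### The operators on `(W₁ ⊗ W₂)^*` and the map `I'` -/

namespace LogTensor

theorem opp_add {At : Type*} [AddCommGroup At] {A : AddSubgroup At}
    {V : Type*} [AddCommGroup V] [Module ℂ V] (S : StronglyGradedVertexAlgebra A V)
    {U : Type*} [AddCommGroup U] [Module ℂ U] {Z Z' : V → ℤ → U}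
    (hZ : ∀ k, Z 0 k = 0) (hZ' : ∀ k, Z' 0 k = 0) (v : V) (n : ℤ) :
    S.opp (fun v k => Z v k + Z' v k) v n = S.opp Z v n + S.opp Z' v n := by
  unfold StronglyGradedVertexAlgebra.opp
  rw [← finsum_add_distrib (opp_outer_finite S hZ v n) (opp_outer_finite S hZ' v n)]
  refine finsum_congr fun h => ?_
  rw [← finsum_add_distrib (opp_inner_finite S hZ _ _ _) (opp_inner_finite S hZ' _ _ _)]
  exact finsum_congr fun m => smul_add _ _ _

namespace ModuleData

variable {At : Type*} [AddCommGroup At] {A : AddSubgroup At}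
  {V : Type*} [AddCommGroup V] [Module ℂ V] {S : StronglyGradedVertexAlgebra A V} {z : ℂ}
  {W₁ W₂ W : ModuleData.{u} V At}

section TensorDual

variable (h₁ : W₁.IsGeneralizedModule S)

/-- An element of `(W₁ ⊗ W₂)^*` as a functional. -/
noncomputable def dualCoe : tensorDual S z W₁ W₂ h₁ →ₗ[ℂ] Module.Dual ℂ (W₁ ⊗[ℂ] W₂) := LinearMap.id

theorem dual_ext {φ ψ : tensorDual S z W₁ W₂ h₁}
    (h : ∀ w₁ w₂, dualCoe h₁ φ (w₁ ⊗ₜ w₂) = dualCoe h₁ ψ (w₁ ⊗ₜ w₂)) : φ = ψ :=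
  TensorProduct.ext' (g := dualCoe h₁ φ) (h := dualCoe h₁ ψ) h

theorem dualCoe_Y (v : V) (n : ℤ) (φ : tensorDual S z W₁ W₂ h₁) (w₁ : W₁) (w₂ : W₂) :
    dualCoe h₁ ((tensorDual S z W₁ W₂ h₁).ops.Y v n φ) (w₁ ⊗ₜ w₂)
      = dualCoe h₁ φ (S.opp (W₁.shiftedY S h₁ z) v n w₁ ⊗ₜ w₂)
        + dualCoe h₁ φ (w₁ ⊗ₜ S.opp W₂.ops.Y v n w₂) :=
  (dualCoe h₁ φ).map_add _ _

theorem dualCoe_Ln1 (φ : tensorDual S z W₁ W₂ h₁) (w₁ : W₁) (w₂ : W₂) :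
    dualCoe h₁ ((tensorDual S z W₁ W₂ h₁).ops.Ln1 φ) (w₁ ⊗ₜ w₂)
      = dualCoe h₁ φ (w₁ ⊗ₜ W₂.ops.L1 w₂) + dualCoe h₁ φ
        ((W₁.ops.L1 w₁ + (2 * z) • W₁.ops.L0 w₁ + z ^ 2 • W₁.ops.Ln1 w₁) ⊗ₜ w₂) :=
  (dualCoe h₁ φ).map_add _ _

theorem dualCoe_L0 (φ : tensorDual S z W₁ W₂ h₁) (w₁ : W₁) (w₂ : W₂) :
    dualCoe h₁ ((tensorDual S z W₁ W₂ h₁).ops.L0 φ) (w₁ ⊗ₜ w₂)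
      = dualCoe h₁ φ (w₁ ⊗ₜ W₂.ops.L0 w₂)
        + dualCoe h₁ φ ((W₁.ops.L0 w₁ + z • W₁.ops.Ln1 w₁) ⊗ₜ w₂) :=
  (dualCoe h₁ φ).map_add _ _

theorem dualCoe_L1 (φ : tensorDual S z W₁ W₂ h₁) (w₁ : W₁) (w₂ : W₂) :
    dualCoe h₁ ((tensorDual S z W₁ W₂ h₁).ops.L1 φ) (w₁ ⊗ₜ w₂)
      = dualCoe h₁ φ (w₁ ⊗ₜ W₂.ops.Ln1 w₂) + dualCoe h₁ φ (W₁.ops.Ln1 w₁ ⊗ₜ w₂) :=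
  (dualCoe h₁ φ).map_add _ _

theorem mem_tensorDual_gr {β : At} {φ : tensorDual S z W₁ W₂ h₁} :
    φ ∈ (tensorDual S z W₁ W₂ h₁).gr β ↔ ∀ γ δ, γ + δ ≠ -β →
      ∀ w₁ ∈ W₁.gr γ, ∀ w₂ ∈ W₂.gr δ, dualCoe h₁ φ (w₁ ⊗ₜ w₂) = 0 := Iff.rfl

theorem shiftedY_apply (v : V) (k : ℤ) (w : W₁) : W₁.shiftedY S h₁ z v k w
    = ∑ᶠ i : ℕ, ((Ring.choose k i : ℤ) * z ^ (k - i)) • W₁.ops.Y v i w := rfl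

theorem shiftedY_zero (k : ℤ) : W₁.shiftedY S h₁ z 0 k = 0 := by
  refine LinearMap.ext fun w => ?_
  rw [shiftedY_apply, LinearMap.zero_apply]
  exact finsum_eq_zero_of_forall_eq_zero fun i => by simp [h₁.Y_zero]

theorem finite_of_truncation (hW : W.IsGeneralizedModule S) (v : V) (n : ℤ) (w : W) {X : Type*}
    [AddCommGroup X] [Module ℂ X] (L : ℕ → W →ₗ[ℂ] X) (c : ℕ → ℂ) :
    (Function.support fun i : ℕ => c i • L i (W.ops.Y v (n + i) w)).Finite := by
  obtain ⟨N, hN⟩ := hW.action.truncation v w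
  refine (Set.finite_Iio (N - n).toNat).subset fun i hi => ?_
  by_contra hlt
  rw [Set.mem_Iio, not_lt] at hlt
  exact hi (by simp only [hN (n + i) (by omega), map_zero, smul_zero])

end TensorDual

theorem contra_apply_of_ne {hW : W.IsGeneralizedModule S}
    (hW' : (W.contragredient S hW).IsGeneralizedModule S) {n m : ℂ}
    {f : W.contragredient S hW} (hf : f ∈ (W.contragredient S hW).wt n) {x : W} (hx : x ∈ W.wt m)
    (hnm : m ≠ n) : contraCoe hW f x = 0 := by
  rw [← gradedProj_of_mem hW'.wt_grading hf, contraCoe_projWt hW hW',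
    gradedProj_of_ne hW.wt_grading hx hnm, map_zero]

theorem contra_pairing_finite (hW : W.IsGeneralizedModule S) (f : W.contragredient S hW)
    {F : ℂ → W} (hF : ∀ n, F n ∈ W.wt n) :
    (Function.support fun n => contraCoe hW f (F n)).Finite :=
  (contra_wt_finite hW (contraCoe_mem hW f)).subset fun n hn => ⟨F n, hF n, hn⟩

section Prime

variable (hW : W.IsGeneralizedModule S) (h₁ : W₁.IsGeneralizedModule S)
  (I : W₁ ⊗[ℂ] W₂ →ₗ[ℂ] (ℂ → W)) (hI : ∀ w n, I w n ∈ W.wt n)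

/-- The map `I' : W' → (W₁ ⊗ W₂)^*`, `I'(w') = w' ∘ I`. -/
noncomputable def primeMap : W.contragredient S hW →ₗ[ℂ] tensorDual S z W₁ W₂ h₁ where
  toFun f :=
    ({ toFun := fun w => ∑ᶠ n, contraCoe hW f (I w n)
       map_add' := fun w w' => by
        rw [← finsum_add_distrib (contra_pairing_finite hW f (hI w))
          (contra_pairing_finite hW f (hI w'))]
        exact finsum_congr fun n => by rw [map_add, Pi.add_apply, map_add]
       map_smul' := fun a w => by
        rw [RingHom.id_apply, smul_finsum' a (contra_pairing_finite hW f (hI w))]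
        exact finsum_congr fun n => by rw [map_smul, Pi.smul_apply, map_smul] } :
      Module.Dual ℂ (W₁ ⊗[ℂ] W₂))
  map_add' f f' := LinearMap.ext fun w => by
    refine Eq.trans ?_ (finsum_add_distrib (contra_pairing_finite hW f (hI w))
          (contra_pairing_finite hW f' (hI w)))
    exact finsum_congr fun n => by rw [map_add, LinearMap.add_apply]
  map_smul' a f := LinearMap.ext fun w => by
    refine Eq.trans ?_ (smul_finsum' a (contra_pairing_finite hW f (hI w))).symm
    exact finsum_congr fun n => by rw [map_smul, LinearMap.smul_apply]

theorem primeMap_apply (f : W.contragredient S hW) (w : W₁ ⊗[ℂ] W₂) :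
    dualCoe h₁ (primeMap (z := z) hW h₁ I hI f) w = ∑ᶠ n, contraCoe hW f (I w n) := rfl

theorem primeMap_of_mem_wt (hW' : (W.contragredient S hW).IsGeneralizedModule S) {n : ℂ}
    {f : W.contragredient S hW} (hf : f ∈ (W.contragredient S hW).wt n) (w : W₁ ⊗[ℂ] W₂) :
    dualCoe h₁ (primeMap (z := z) hW h₁ I hI f) w = contraCoe hW f (I w n) := by
  rw [primeMap_apply, finsum_eq_single _ n]
  intro m hm
  exact contra_apply_of_ne hW' hf (hI w m) hm

end Prime

theorem choose_zero_cast {i : ℕ} (hi : i ≠ 0) : (Ring.choose (0 : ℤ) i : ℤ) = 0 := by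
  obtain ⟨j, rfl⟩ := Nat.exists_eq_succ_of_ne_zero hi
  exact Ring.choose_zero_succ ℤ j

/-- The commutator formula: the coefficient of `x₀⁻¹` in the Jacobi identity. -/
theorem IsIntertwiningMap.Y_apply {I : W₁ ⊗[ℂ] W₂ →ₗ[ℂ] (ℂ → W)} (hI : IsIntertwiningMap S z I)
    (h₁ : W₁.IsGeneralizedModule S) {h : ℤ} {v : V}
    (hv : v ∈ Module.End.eigenspace S.L0 (h : ℂ)) (w₁ : W₁) (w₂ : W₂) (k : ℤ) (p : ℂ) :
    W.ops.Y v k (I (w₁ ⊗ₜ w₂) (p + k + 1 - h))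
      = I (W₁.shiftedY S h₁ z v k w₁ ⊗ₜ w₂) p + I (w₁ ⊗ₜ W₂.ops.Y v k w₂) p := by
  -- With `n = 0` the binomials `(0 choose i)` leave only `i = 0` in the first and last sums; the
  -- middle sum is the expansion of `(z + t)^k` defining `shiftedY`.
  have hj := hI.jacobi h v hv w₁ w₂ 0 k p
  rw [finsum_eq_single _ 0 fun i hi => by simp [choose_zero_cast hi],
    finsum_eq_single (fun i : ℕ => ((-1 : ℂ) ^ (0 + (i : ℤ)) * (Ring.choose (0 : ℤ) i : ℤ)
      * z ^ ((0 : ℤ) - i)) • I (w₁ ⊗ₜ W₂.ops.Y v (k + i) w₂) p) 0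
      fun i hi => by simp [choose_zero_cast hi]] at hj
  simp only [Ring.choose_zero_right, Int.cast_one, pow_zero, mul_one, one_smul, add_zero,
    Nat.cast_zero, sub_zero, zpow_zero, zero_add] at hj
  rw [hj, shiftedY_apply]
  congr 1
  let L : W₁ →ₗ[ℂ] W := LinearMap.proj p ∘ₗ I ∘ₗ (TensorProduct.mk ℂ W₁ W₂).flip w₂
  have hfin := finite_of_truncation h₁ v 0 w₁ (fun _ => LinearMap.id)
    fun i : ℕ => ((Ring.choose k i : ℤ) * z ^ (k - i) : ℂ)
  simp only [zero_add, LinearMap.id_apply] at hfin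
  refine Eq.trans ?_ (L.toAddMonoidHom.map_finsum hfin).symm
  exact finsum_congr fun i => (map_smul L _ _).symm

/-- `I'` is a map of generalized modules (up to the axioms for its target). -/
theorem IsIntertwiningMap.isHom_primeMap {I : W₁ ⊗[ℂ] W₂ →ₗ[ℂ] (ℂ → W)}
    (hI : IsIntertwiningMap S z I) (hW : W.IsGeneralizedModule S)
    (hW' : (W.contragredient S hW).IsGeneralizedModule S) (h₁ : W₁.IsGeneralizedModule S)
    (h₂ : W₂.IsGeneralizedModule S) :
    IsHom (primeMap (z := z) hW h₁ I hI.mem_completion) where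
  map_Y v n f := by
    set J := primeMap (z := z) hW h₁ I hI.mem_completion with hJ
    refine dual_ext h₁ fun w₁ w₂ => ?_
    rw [dualCoe_Y]
    -- Writing the action on `W'` as the opposite of its opposite displays both sides as opposite
    -- families. It then suffices to compare the families themselves at homogeneous `v`, where the
    -- commutator formula applies.
    have e1 := map_opp S (LinearMap.applyₗ (w₁ ⊗ₜ[ℂ] w₂) ∘ₗ dualCoe h₁ ∘ₗ J ∘ₗ LinearMap.applyₗ f)
      (opp_zero S hW'.Y_zero) v n
    rw [opp_opp S fun v w k => hW'.action.Y_add v w k] at e1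
    have e2 := map_opp S (dualCoe h₁ (J f) ∘ₗ (TensorProduct.mk ℂ W₁ W₂).flip w₂ ∘ₗ
      LinearMap.applyₗ w₁) (shiftedY_zero (z := z) h₁) v n
    have e3 := map_opp S (dualCoe h₁ (J f) ∘ₗ TensorProduct.mk ℂ W₁ W₂ w₁ ∘ₗ
      LinearMap.applyₗ w₂) h₂.Y_zero v n
    refine e1.trans (Eq.trans ?_ (congrArg₂ (· + ·) e2.symm e3.symm))
    rw [← opp_add S]
    rotate_left
    · intro k; rw [shiftedY_zero, map_zero]
    · intro k; rw [h₂.Y_zero, map_zero]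
    refine opp_congr S (fun h v hv k => ?_) v n
    change ∑ᶠ p, contraCoe hW (S.opp (W.contragredient S hW).ops.Y v k f) (I (w₁ ⊗ₜ w₂) p)
      = ∑ᶠ p, contraCoe hW f (I (W₁.shiftedY S h₁ z v k w₁ ⊗ₜ w₂) p)
        + ∑ᶠ p, contraCoe hW f (I (w₁ ⊗ₜ W₂.ops.Y v k w₂) p)
    -- The sum over weights is reindexed by `k + 1 - h` to undo the weight shift `h - k - 1` of
    -- `v_k`.
    rw [← finsum_add_distrib (contra_pairing_finite hW f (hI.mem_completion _))
      (contra_pairing_finite hW f (hI.mem_completion _)), contraCoe_opp_Y,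
      ← finsum_comp_equiv (Equiv.addRight ((k : ℂ) + 1 - h))]
    refine finsum_congr fun p => ?_
    rw [← map_add, ← hI.Y_apply h₁ hv, Equiv.coe_addRight, LinearMap.comp_apply,
      show p + k + 1 - h = p + (k + 1 - h) by ring]
  map_Ln1 f := by
    refine dual_ext h₁ fun w₁ w₂ => ?_
    rw [dualCoe_Ln1, primeMap_apply, primeMap_apply, primeMap_apply,
      ← finsum_add_distrib (contra_pairing_finite hW f (hI.mem_completion _))
      (contra_pairing_finite hW f (hI.mem_completion _)), contraCoe_Ln1,
      ← finsum_comp_equiv (Equiv.addRight (1 : ℂ))]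
    refine finsum_congr fun p => ?_
    rw [← map_add, Equiv.coe_addRight, LinearMap.comp_apply, hI.bracket_pos]
    simp only [TensorProduct.add_tmul, ← TensorProduct.smul_tmul', map_add, map_smul, Pi.add_apply,
      Pi.smul_apply, add_assoc]
  map_L0 f := by
    refine dual_ext h₁ fun w₁ w₂ => ?_
    rw [dualCoe_L0, primeMap_apply, primeMap_apply, primeMap_apply,
      ← finsum_add_distrib (contra_pairing_finite hW f (hI.mem_completion _))
      (contra_pairing_finite hW f (hI.mem_completion _)), contraCoe_L0]
    refine finsum_congr fun p => ?_
    rw [← map_add, LinearMap.comp_apply, hI.bracket_zero]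
    simp only [TensorProduct.add_tmul, ← TensorProduct.smul_tmul', map_add, map_smul, Pi.add_apply,
      Pi.smul_apply, add_assoc]
  map_L1 f := by
    refine dual_ext h₁ fun w₁ w₂ => ?_
    rw [dualCoe_L1, primeMap_apply, primeMap_apply, primeMap_apply,
      ← finsum_add_distrib (contra_pairing_finite hW f (hI.mem_completion _))
      (contra_pairing_finite hW f (hI.mem_completion _)), contraCoe_L1,
      ← finsum_comp_equiv (Equiv.subRight (1 : ℂ))]
    refine finsum_congr fun p => ?_
    rw [← map_add, Equiv.subRight_apply, LinearMap.comp_apply, hI.bracket_neg]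
  map_gr β f hf := by
    rw [mem_tensorDual_gr]
    intro γ δ hne w₁ hw₁ w₂ hw₂
    rw [primeMap_apply]
    exact finsum_eq_zero_of_forall_eq_zero fun n =>
      (mem_contra_gr hW).mp hf _ hne _ (hI.grading _ _ w₁ hw₁ w₂ hw₂ n)

end ModuleData
end LogTensor

/-! ### The map `J'`: intertwining property and universal property -/

namespace LogTensor.ModuleData

/-- The left side of the Jacobi identity in a fixed weight is a finite sum: its `i`-th term involves
the component of `F` whose weight is `i` below a fixed one. -/
theorem finsum_of_lower_truncation {At V : Type*} [AddCommGroup V] [Module ℂ V]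
    {W : ModuleData.{u} V At} {F : ℂ → W}
    (hF : ∀ n : ℂ, ∃ N : ℕ, ∀ m : ℕ, N ≤ m → F (n - m) = 0) (T : ℤ → Module.End ℂ W) (m : ℤ)
    (p q : ℂ) {X : Type*} [AddCommGroup X] [Module ℂ X] (L : W →ₗ[ℂ] X) (c : ℕ → ℂ) :
    L (∑ᶠ i : ℕ, c i • T (m - i) (F (p + ((m - i : ℤ) : ℂ) + 1 - q)))
      = ∑ᶠ i : ℕ, c i • L (T (m - i) (F (p + ((m - i : ℤ) : ℂ) + 1 - q))) := by
  obtain ⟨N, hN⟩ := hF (p + m + 1 - q)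
  have hfin : (Function.support fun i : ℕ =>
      c i • T (m - i) (F (p + ((m - i : ℤ) : ℂ) + 1 - q))).Finite := by
    refine (Set.finite_Iio N).subset fun i hi => ?_
    by_contra hlt
    rw [Set.mem_Iio, not_lt] at hlt
    refine hi ?_
    have h := hN i hlt
    rw [show p + m + 1 - q - (i : ℂ) = p + ((m - i : ℤ) : ℂ) + 1 - q by push_cast; ring] at h
    simp only [h, map_zero, smul_zero]
  exact (L.toAddMonoidHom.map_finsum hfin).trans (finsum_congr fun _ => map_smul L _ _)

/-- Maps into an embedded module lift along the embedding. -/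
theorem IsHom.exists_lift {At V : Type*} [AddCommGroup V] [Module ℂ V]
    {M N X : ModuleData.{u} V At} {J : N →ₗ[ℂ] X} (hJ : IsHom J)
    (hinj : Function.Injective J) (hgr : ∀ β x, J x ∈ X.gr β → x ∈ N.gr β) {P : M →ₗ[ℂ] X}
    (hP : IsHom P) (hrange : ∀ m, ∃ x, J x = P m) :
    ∃ K : M →ₗ[ℂ] N, IsHom K ∧ ∀ m, J (K m) = P m := by
  choose K hK using hrange
  let K' : M →ₗ[ℂ] N :=
    { toFun := K
      map_add' := fun a b => hinj (by rw [hK, map_add, map_add, hK, hK])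
      map_smul' := fun a b => hinj (by rw [hK, map_smul, RingHom.id_apply, map_smul, hK]) }
  have hK' : ∀ m, J (K' m) = P m := hK
  refine ⟨K', ⟨fun v n w => hinj ?_, fun w => hinj ?_, fun w => hinj ?_, fun w => hinj ?_,
    fun β w hw => hgr _ _ ?_⟩, hK'⟩
  · rw [hK', hJ.map_Y, hK', hP.map_Y]
  · rw [hK', hJ.map_Ln1, hK', hP.map_Ln1]
  · rw [hK', hJ.map_L0, hK', hP.map_L0]
  · rw [hK', hJ.map_L1, hK', hP.map_L1]
  · rw [hK']; exact hP.map_gr β w hw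

variable {At : Type*} [AddCommGroup At] {A : AddSubgroup At}
  {V : Type*} [AddCommGroup V] [Module ℂ V] {S : StronglyGradedVertexAlgebra A V} {z : ℂ}
  {W₁ W₂ W N : ModuleData.{u} V At}

theorem tensor_induction (h₁ : W₁.IsGeneralizedModule S) (h₂ : W₂.IsGeneralizedModule S)
    {Q : Submodule ℂ (W₁ ⊗[ℂ] W₂)}
    (h : ∀ γ δ, ∀ w₁ ∈ W₁.gr γ, ∀ w₂ ∈ W₂.gr δ, w₁ ⊗ₜ w₂ ∈ Q) (w : W₁ ⊗[ℂ] W₂) : w ∈ Q := by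
  induction w with
  | zero => exact Q.zero_mem
  | add x y hx hy => exact Q.add_mem hx hy
  | tmul w₁ w₂ =>
    refine h₁.gr_grading.le_of_forall
      (Q := Q.comap ((TensorProduct.mk ℂ W₁ W₂).flip w₂)) (fun γ x hx => ?_) w₁
    exact h₂.gr_grading.le_of_forall
      (Q := Q.comap (TensorProduct.mk ℂ W₁ W₂ x)) (fun δ y hy => h γ δ x hx y hy) w₂

theorem projWt_shift (hW : W.IsGeneralizedModule S) {T : Module.End ℂ W} {c : ℂ}
    (hT : ∀ n, ∀ x ∈ W.wt n, T x ∈ W.wt (n + c)) {n m : ℂ} (hm : m = n + c) (x : W) :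
    gradedProj hW.wt_grading m (T x) = T (gradedProj hW.wt_grading n x) := by
  classical
  subst hm
  refine LinearMap.congr_fun (hW.wt_grading.hom_ext (f := gradedProj hW.wt_grading (n + c) ∘ₗ T)
    (f' := T ∘ₗ gradedProj hW.wt_grading n) fun r y hy => ?_) x
  rw [LinearMap.comp_apply, LinearMap.comp_apply, gradedProj_apply_eq hW.wt_grading (hT r y hy),
    gradedProj_apply_eq hW.wt_grading hy]
  simp only [add_left_inj]
  split_ifs <;> simp

theorem finsum_of_truncation (hW : W.IsGeneralizedModule S) (v : V) (n : ℤ) (w : W)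
    {X Y : Type*} [AddCommGroup X] [Module ℂ X] [AddCommGroup Y] [Module ℂ Y]
    (G : W →ₗ[ℂ] X) (L : X →ₗ[ℂ] Y) (c : ℕ → ℂ) :
    L (∑ᶠ i : ℕ, c i • G (W.ops.Y v (n + i) w)) = ∑ᶠ i : ℕ, c i • L (G (W.ops.Y v (n + i) w)) :=
  (L.toAddMonoidHom.map_finsum (finite_of_truncation hW v n w (fun _ => G) c)).trans
    (finsum_congr fun _ => map_smul L _ _)

theorem mem_contra_wt_of_vanish (hW : W.IsGeneralizedModule S)
    (hW' : (W.contragredient S hW).IsGeneralizedModule S) {n : ℂ} {f : W.contragredient S hW}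
    (hf : ∀ m, m ≠ n → ∀ x ∈ W.wt m, contraCoe hW f x = 0) : f ∈ (W.contragredient S hW).wt n := by
  refine mem_of_gradedProj_eq_zero hW'.wt_grading fun m hm => contraCoe_injective hW ?_
  refine LinearMap.ext fun x => ?_
  rw [contraCoe_projWt hW hW', hf m hm _ (gradedProj_mem hW.wt_grading m x), map_zero,
    LinearMap.zero_apply]

section EvalMap

variable (h₁ : W₁.IsGeneralizedModule S) (h₂ : W₂.IsGeneralizedModule S)
  (hN : N.IsGeneralizedModule S) (J : N →ₗ[ℂ] tensorDual S z W₁ W₂ h₁)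

/-- The functional `x ↦ J(x_n)(w)` on `N`, where `x_n` is the component of `x` of weight `n`. -/
noncomputable def evalFunctional (n : ℂ) : W₁ ⊗[ℂ] W₂ →ₗ[ℂ] Module.Dual ℂ N :=
  (dualCoe h₁ ∘ₗ J ∘ₗ gradedProj hN.wt_grading n).flip

theorem evalFunctional_apply (n : ℂ) (w : W₁ ⊗[ℂ] W₂) (x : N) :
    evalFunctional h₁ hN J n w x = dualCoe h₁ (J (gradedProj hN.wt_grading n x)) w := rfl

variable {J} (hJ : IsHom J)

theorem evalFunctional_mem (h₂ : W₂.IsGeneralizedModule S) (hJ : IsHom J) (n : ℂ) (w : W₁ ⊗[ℂ] W₂) :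
    evalFunctional h₁ hN J n w ∈ N.contraSpace := by
  refine tensor_induction h₁ h₂ (Q := N.contraSpace.comap (evalFunctional h₁ hN J n))
    (fun γ δ w₁ hw₁ w₂ hw₂ => ?_) w
  -- On homogeneous `w₁ ⊗ w₂` a functional of degree `β` vanishes unless `β = -(γ + δ)`, so a single
  -- bidegree of `N` contributes.
  refine (Set.finite_singleton (-(γ + δ), n)).subset ?_
  rintro ⟨β, m⟩ ⟨x, hx, h⟩
  rw [evalFunctional_apply] at h
  have hm : m = n := by
    by_contra hm
    exact h (by rw [gradedProj_of_ne hN.wt_grading hx.2 hm, map_zero, map_zero,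
      LinearMap.zero_apply])
  have hβ : β = -(γ + δ) := by
    by_contra hβ
    refine h ((mem_tensorDual_gr h₁).mp (hJ.map_gr β _ (projWt_mem_gr hN hx.1 n)) γ δ ?_ w₁ hw₁
      w₂ hw₂)
    exact fun h => hβ (by rw [h, neg_neg])
  exact Set.mem_singleton_iff.mpr (Prod.ext hβ hm)

/-- The map `J'` for a map `J : N → (W₁ ⊗ W₂)^*`. -/
noncomputable def evalMap : W₁ ⊗[ℂ] W₂ →ₗ[ℂ] (ℂ → N.contragredient S hN) :=
  LinearMap.pi fun n =>
    LinearMap.codRestrict N.contraSpace (evalFunctional h₁ hN J n)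
      (evalFunctional_mem h₁ hN h₂ hJ n)

theorem evalMap_apply (w : W₁ ⊗[ℂ] W₂) (n : ℂ) (x : N) :
    contraCoe hN (evalMap h₁ h₂ hN hJ w n) x
      = dualCoe h₁ (J (gradedProj hN.wt_grading n x)) w := rfl

theorem evalMap_mem_wt (hN' : (N.contragredient S hN).IsGeneralizedModule S)
    (w : W₁ ⊗[ℂ] W₂) (n : ℂ) :
    evalMap h₁ h₂ hN hJ w n ∈ (N.contragredient S hN).wt n := by
  refine mem_contra_wt_of_vanish hN hN' fun m hm x hx => ?_
  rw [evalMap_apply, gradedProj_of_ne hN.wt_grading hx hm, map_zero, map_zero,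
    LinearMap.zero_apply]

theorem finsum_evalMap (w : W₁ ⊗[ℂ] W₂) (x : N) :
    ∑ᶠ n, contraCoe hN (evalMap h₁ h₂ hN hJ w n) x = dualCoe h₁ (J x) w :=
  (map_eq_finsum_gradedProj hN.wt_grading (LinearMap.applyₗ w ∘ₗ dualCoe h₁ ∘ₗ J) x).symm

theorem evalMap_grading {β γ : At} {w₁ : W₁} (hw₁ : w₁ ∈ W₁.gr β) {w₂ : W₂} (hw₂ : w₂ ∈ W₂.gr γ)
    (n : ℂ) : evalMap h₁ h₂ hN hJ (w₁ ⊗ₜ w₂) n ∈ (N.contragredient S hN).gr (β + γ) := by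
  rw [mem_contra_gr]
  intro δ hδ x hx
  rw [evalMap_apply]
  refine (mem_tensorDual_gr h₁).mp (hJ.map_gr δ _ (projWt_mem_gr hN hx n)) β γ ?_ w₁ hw₁ w₂ hw₂
  exact fun h => hδ (by rw [h, neg_neg])

theorem evalMap_truncation (w : W₁ ⊗[ℂ] W₂) (n : ℂ) :
    ∃ M : ℕ, ∀ m : ℕ, M ≤ m → evalMap h₁ h₂ hN hJ w (n - m) = 0 := by
  let Q : Submodule ℂ (W₁ ⊗[ℂ] W₂) :=
    { carrier := {w | ∃ M : ℕ, ∀ m : ℕ, M ≤ m → evalMap h₁ h₂ hN hJ w (n - m) = 0}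
      zero_mem' := ⟨0, fun m _ => by rw [map_zero]; rfl⟩
      add_mem' := by
        rintro a b ⟨M, hM⟩ ⟨M', hM'⟩
        refine ⟨max M M', fun m hm => ?_⟩
        rw [map_add, Pi.add_apply, hM m (le_of_max_le_left hm), hM' m (le_of_max_le_right hm),
          add_zero]
      smul_mem' := by
        rintro c a ⟨M, hM⟩
        exact ⟨M, fun m hm => by rw [map_smul, Pi.smul_apply, hM m hm, smul_zero]⟩ }
  refine tensor_induction h₁ h₂ (Q := Q) (fun γ δ w₁ hw₁ w₂ hw₂ => ?_) w
  -- Only the degree `-(γ + δ)` of `N` pairs with `w₁ ⊗ w₂`, and weights there are truncated below.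
  -- The bound `1 - K` makes `-m < K` whenever `m` is at least that large.
  obtain ⟨K, hK⟩ := hN.wt_truncation (-(γ + δ)) n
  refine ⟨(1 - K).toNat, fun m hm => contraCoe_injective hN (hN.gr_grading.hom_ext fun β x hx => ?_)⟩
  rw [map_zero, LinearMap.zero_apply]
  by_cases hβ : γ + δ = -β
  · have h0 : gradedProj hN.wt_grading (n - m) x ∈ N.gr (-(γ + δ)) ⊓ N.wt (n + ((-m : ℤ) : ℂ)) := by
      refine ⟨?_, ?_⟩
      · rw [hβ, neg_neg]; exact projWt_mem_gr hN hx _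
      · have := gradedProj_mem hN.wt_grading (n - m) x
        rwa [show n + ((-m : ℤ) : ℂ) = n - m by push_cast; ring]
    rw [hK _ (by omega)] at h0
    rw [evalMap_apply, (Submodule.mem_bot ℂ).mp h0, map_zero, map_zero, LinearMap.zero_apply]
  · exact (mem_tensorDual_gr h₁).mp (hJ.map_gr β _ (projWt_mem_gr hN hx _)) γ δ hβ w₁ hw₁ w₂ hw₂

/-- If every element of the image of `J` comes from an intertwining map, then `J'` is an
intertwining map. -/
theorem evalMap_intertwining {hN' : (N.contragredient S hN).IsGeneralizedModule S}
    (hinj : Function.Injective J) (hgr : ∀ β x, J x ∈ (tensorDual S z W₁ W₂ h₁).gr β → x ∈ N.gr β)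
    (hprime : ∀ x, ∃ (W : ModuleData.{u} V At) (hW : W.IsGeneralizedModule S)
      (_ : (W.contragredient S hW).IsGeneralizedModule S) (I : W₁ ⊗[ℂ] W₂ →ₗ[ℂ] (ℂ → W))
      (hI : IsIntertwiningMap S z I), (∃ f, primeMap hW h₁ I hI.mem_completion f = J x) ∧
      ∀ f, ∃ y, J y = primeMap hW h₁ I hI.mem_completion f) :
    IsIntertwiningMap S z (evalMap h₁ h₂ hN hJ) where
  mem_completion := evalMap_mem_wt h₁ h₂ hN hJ hN'
  grading _ _ _ hw₁ _ hw₂ n := evalMap_grading h₁ h₂ hN hJ hw₁ hw₂ n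
  truncation w₁ w₂ := evalMap_truncation h₁ h₂ hN hJ (w₁ ⊗ₜ w₂)
  jacobi h v hv w₁ w₂ n m p := by
    refine contraCoe_injective hN (LinearMap.ext fun x => ?_)
    -- The identity is tested against `x`. In weight `p` only the component `y` matters, and `y`
    -- comes from an intertwining map `I`, through which everything below is computed.
    let y := gradedProj hN.wt_grading p x
    have hy : y ∈ N.wt p := gradedProj_mem hN.wt_grading p x
    obtain ⟨W, hW, hW', I, hI, ⟨f₀, hf₀⟩, hall⟩ := hprime y
    obtain ⟨K, hK, hJK⟩ := hJ.exists_lift hinj hgr (hI.isHom_primeMap hW hW' h₁ h₂) hall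
    -- A preimage of `y` may be replaced by its component of weight `p`, because `K` preserves
    -- weights.
    obtain ⟨f, hf, hfy⟩ : ∃ f ∈ (W.contragredient S hW).wt p, K f = y := by
      refine ⟨_, gradedProj_mem hW'.wt_grading p f₀, ?_⟩
      have h0 : K f₀ = y := hinj (by rw [hJK, hf₀])
      rw [map_gradedProj hW'.wt_grading hN.wt_grading K hK.map_wt, h0,
        gradedProj_of_mem hN.wt_grading hy]
    have hpair : ∀ w, contraCoe hN (evalMap h₁ h₂ hN hJ w p) x = contraCoe hW f (I w p) := by
      intro w
      rw [evalMap_apply]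
      change dualCoe h₁ (J y) w = _
      rw [← hfy, hJK, primeMap_of_mem_wt hW h₁ I _ hW' hf]
    -- The operator `v_k` on `N'` moves to its opposite on `N`, passes through `K` to the opposite
    -- on `W'`, and returns to `v_k` on `W`. The weights match since the opposite operator has
    -- weight `k + 1 - h`.
    have hpairY : ∀ w k, contraCoe hN ((N.contragredient S hN).ops.Y v k
        (evalMap h₁ h₂ hN hJ w (p + k + 1 - h))) x
        = contraCoe hW f (W.ops.Y v k (I w (p + k + 1 - h))) := by
      intro w k
      rw [contraCoe_Y, LinearMap.comp_apply, evalMap_apply,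
        projWt_shift hN (T := S.opp N.ops.Y v k) (c := k + 1 - h) (n := p)
          (fun n x hx => by
            have := hN.opp_Y_mem_wt hv k hx
            rwa [show n + k + 1 - h = n + (k + 1 - h : ℂ) by ring] at this) (by ring)]
      change dualCoe h₁ (J (S.opp N.ops.Y v k y)) w = _
      rw [← hfy, ← opp_comm hW' hN hK.map_Y, hJK,
        primeMap_of_mem_wt hW h₁ I _ hW' (hW'.opp_Y_mem_wt hv k hf), contraCoe_opp_Y,
        LinearMap.comp_apply]
    have hj := congrArg (contraCoe hW f) (hI.jacobi h v hv w₁ w₂ n m p)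
    let E : N.contragredient S hN →ₗ[ℂ] ℂ := LinearMap.applyₗ x ∘ₗ contraCoe hN
    have hE : ∀ g, contraCoe hN g x = E g := fun _ => rfl
    rw [hE, hE]
    rw [map_add] at hj ⊢
    have l1 := finsum_of_lower_truncation (hI.truncation w₁ w₂) (W.ops.Y v) (m + n) p h
      (contraCoe hW f) fun i => (Ring.choose n i : ℤ) * (-z) ^ i
    have l2 := finsum_of_lower_truncation (evalMap_truncation h₁ h₂ hN hJ (w₁ ⊗ₜ w₂))
      ((N.contragredient S hN).ops.Y v) (m + n) p h E fun i => (Ring.choose n i : ℤ) * (-z) ^ i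
    have r1 := finsum_of_truncation h₁ v n w₁
      (LinearMap.proj p ∘ₗ I ∘ₗ (TensorProduct.mk ℂ W₁ W₂).flip w₂) (contraCoe hW f)
      fun i => (Ring.choose m i : ℤ) * z ^ (m - i)
    have r2 := finsum_of_truncation h₁ v n w₁
      (LinearMap.proj p ∘ₗ evalMap h₁ h₂ hN hJ ∘ₗ (TensorProduct.mk ℂ W₁ W₂).flip w₂) E
      fun i => (Ring.choose m i : ℤ) * z ^ (m - i)
    have s1 := finsum_of_truncation h₂ v m w₂
      (LinearMap.proj p ∘ₗ I ∘ₗ TensorProduct.mk ℂ W₁ W₂ w₁) (contraCoe hW f)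
      fun i => (-1 : ℂ) ^ (n + i) * (Ring.choose n i : ℤ) * z ^ (n - i)
    have s2 := finsum_of_truncation h₂ v m w₂
      (LinearMap.proj p ∘ₗ evalMap h₁ h₂ hN hJ ∘ₗ TensorProduct.mk ℂ W₁ W₂ w₁) E
      fun i => (-1 : ℂ) ^ (n + i) * (Ring.choose n i : ℤ) * z ^ (n - i)
    -- Term by term, the identity for `J'` paired with `x` is now the identity for `I` paired with
    -- `f`.
    refine l2.trans (Eq.trans ?_ (congrArg₂ (· + ·) r2 s2).symm)
    have hj' := l1.symm.trans (hj.trans (congrArg₂ (· + ·) r1 s1))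
    refine Eq.trans (finsum_congr fun i => ?_) (hj'.trans (congrArg₂ (· + ·)
      (finsum_congr fun i => ?_) (finsum_congr fun i => ?_)))
    · rw [← hE, hpairY]
    · exact congrArg _ (hpair _).symm
    · exact congrArg _ (hpair _).symm
  bracket_neg w₁ w₂ p := by
    refine contraCoe_injective hN (LinearMap.ext fun x => ?_)
    rw [contraCoe_Ln1, LinearMap.comp_apply, evalMap_apply,
      projWt_shift hN (c := -1) (n := p) 
        (fun n => N.shift_wt _ _ (by rw [hN.action.sl2_zero_pos, neg_one_smul]) n) (by ring),
      hJ.map_L1, dualCoe_L1]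
    rfl
  bracket_zero w₁ w₂ p := by
    refine contraCoe_injective hN (LinearMap.ext fun x => ?_)
    rw [contraCoe_L0, LinearMap.comp_apply, evalMap_apply,
      projWt_shift hN (c := 0) (n := p) (fun n => N.shift_wt _ _ (by rw [sub_self, zero_smul]) n)
        (by ring), hJ.map_L0, dualCoe_L0]
    simp only [TensorProduct.add_tmul, ← TensorProduct.smul_tmul', map_add, map_smul,
      LinearMap.add_apply, LinearMap.smul_apply, evalMap_apply, add_assoc]
  bracket_pos w₁ w₂ p := by
    refine contraCoe_injective hN (LinearMap.ext fun x => ?_)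
    rw [contraCoe_L1, LinearMap.comp_apply, evalMap_apply,
      projWt_shift hN (c := 1) (n := p)
        (fun n => N.shift_wt _ _ (by rw [hN.action.sl2_zero_neg, one_smul]) n) rfl,
      hJ.map_Ln1, dualCoe_Ln1]
    simp only [TensorProduct.add_tmul, ← TensorProduct.smul_tmul', map_add, map_smul,
      LinearMap.add_apply, LinearMap.smul_apply, evalMap_apply, add_assoc]

/-- The universal property of `J'`, for one intertwining map. -/
theorem existsUnique_hom_of_evalMap (hinj : Function.Injective J)
    (hgr : ∀ β x, J x ∈ (tensorDual S z W₁ W₂ h₁).gr β → x ∈ N.gr β)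
    (hW : W.IsGeneralizedModule S) (hW' : (W.contragredient S hW).IsGeneralizedModule S)
    {I : W₁ ⊗[ℂ] W₂ →ₗ[ℂ] (ℂ → W)} (hI : IsIntertwiningMap S z I)
    (hrange : ∀ f, ∃ y, J y = primeMap hW h₁ I hI.mem_completion f) :
    ∃! η : N.contragredient S hN →ₗ[ℂ] W, IsHom η ∧ ∀ w n, η (evalMap h₁ h₂ hN hJ w n) = I w n := by
  obtain ⟨K, hK, hJK⟩ := hJ.exists_lift hinj hgr (hI.isHom_primeMap hW hW' h₁ h₂) hrange
  -- `η` is the transpose of `K : W' → N`, regarded as a map into `W` through `W'' = W`.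
  obtain ⟨η, hη⟩ := exists_linear_eval hW (LinearMap.lcomp ℂ ℂ K ∘ₗ contraCoe hN)
    fun f => hK.comp_mem_contraSpace (contraCoe_mem hN f)
  replace hη : ∀ g f, contraCoe hW f (η g) = contraCoe hN g (K f) := hη
  refine ⟨η, ⟨⟨fun v n g => ?_, fun g => ?_, fun g => ?_, fun g => ?_, fun β g hg => ?_⟩,
    fun w n => ?_⟩, fun θ hθ => ?_⟩
  · refine contra_separates hW fun f => ?_
    rw [hη, contraCoe_Y, LinearMap.comp_apply, ← opp_comm hW' hN hK.map_Y, ← hη, contraCoe_opp_Y,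
      LinearMap.comp_apply]
  · refine contra_separates hW fun f => ?_
    rw [hη, contraCoe_Ln1, LinearMap.comp_apply, ← hK.map_L1, ← hη, contraCoe_L1,
      LinearMap.comp_apply]
  · refine contra_separates hW fun f => ?_
    rw [hη, contraCoe_L0, LinearMap.comp_apply, ← hK.map_L0, ← hη, contraCoe_L0,
      LinearMap.comp_apply]
  · refine contra_separates hW fun f => ?_
    rw [hη, contraCoe_L1, LinearMap.comp_apply, ← hK.map_Ln1, ← hη, contraCoe_Ln1,
      LinearMap.comp_apply]
  · refine mem_gr_of_contra hW fun γ hγ f hf => ?_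
    rw [hη]
    exact (mem_contra_gr hN).mp hg γ hγ _ (hK.map_gr γ f hf)
  · refine contra_separates hW fun f => ?_
    rw [hη, evalMap_apply, ← map_gradedProj hW'.wt_grading hN.wt_grading K hK.map_wt, hJK,
      primeMap_of_mem_wt hW h₁ I _ hW' (gradedProj_mem hW'.wt_grading n f), contraCoe_projWt hW hW',
      gradedProj_of_mem hW.wt_grading (hI.mem_completion w n)]
  · refine LinearMap.ext fun g => contra_separates hW fun f => ?_
    -- For uniqueness, the transpose of `θ` sends `f` to an element of `N'' = N`, represented by
    -- `x`. The condition on `θ` gives `J x = I'(f) = J (K f)`, and `J` is injective.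
    obtain ⟨x, hx⟩ := exists_eval hN (hθ.1.comp_mem_contraSpace (contraCoe_mem hW f))
    replace hx : ∀ g, contraCoe hW f (θ g) = contraCoe hN g x := hx
    have hxK : x = K f := by
      refine hinj (Eq.trans (dual_ext h₁ fun w₁ w₂ => ?_) (hJK f).symm)
      rw [← finsum_evalMap h₁ h₂ hN hJ, primeMap_apply]
      exact finsum_congr fun n => by rw [← hx, hθ.2]
    rw [hx, hη, hxK]

end EvalMap

end LogTensor.ModuleData

/-! ### Stable subspaces and images of modules -/

namespace LogTensor.ModuleData

section Sub

variable {At V : Type*} [AddCommGroup V] [Module ℂ V] {X : ModuleData.{u} V At}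
  (U : Submodule ℂ X) (hU : X.IsStable U)

/-- The inclusion of a stable subspace. -/
def subCoe : X.sub U hU →ₗ[ℂ] X := U.subtype

theorem isHom_subCoe : IsHom (subCoe U hU) :=
  ⟨fun _ _ _ => rfl, fun _ => rfl, fun _ => rfl, fun _ => rfl, fun _ _ hw => hw⟩

theorem subCoe_injective : Function.Injective (subCoe U hU) := U.injective_subtype

theorem exists_subCoe_eq {x : X} : (∃ y, subCoe U hU y = x) ↔ x ∈ U :=
  ⟨fun ⟨y, hy⟩ => hy ▸ y.2, fun hx => ⟨⟨x, hx⟩, rfl⟩⟩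

theorem IsHom.isStable_range {M : ModuleData.{u} V At} {f : M →ₗ[ℂ] X} (hf : IsHom f) :
    X.IsStable (LinearMap.range f) where
  Y v n x := by rintro ⟨m, rfl⟩; exact ⟨_, hf.map_Y v n m⟩
  Ln1 x := by rintro ⟨m, rfl⟩; exact ⟨_, hf.map_Ln1 m⟩
  L0 x := by rintro ⟨m, rfl⟩; exact ⟨_, hf.map_L0 m⟩
  L1 x := by rintro ⟨m, rfl⟩; exact ⟨_, hf.map_L1 m⟩

end Sub

variable {At : Type*} [AddCommGroup At] {A : AddSubgroup At}
  {V : Type*} [AddCommGroup V] [Module ℂ V] {S : StronglyGradedVertexAlgebra A V} {z : ℂ}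
  {W₁ W₂ W M N P : ModuleData.{u} V At}

section Image

variable {φ : M →ₗ[ℂ] P}

/-- Each axiom is a condition on vectors that `φ` transports, and every vector is `φ m`. The sums in
the Jacobi identity are finite by truncation, in `M` for the left side and in `V` for the right, so
`φ` passes through them. -/
theorem IsHom.isAction_of_surjective (hφ : IsHom φ) (hs : Function.Surjective φ)
    (hM : M.IsGeneralizedModule S) : IsAction S.toVertexData P.ops where
  Y_add u v n := LinearMap.ext fun x => by
    obtain ⟨m, rfl⟩ := hs x
    rw [LinearMap.add_apply, ← hφ.map_Y, ← hφ.map_Y, ← hφ.map_Y, hM.action.Y_add,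
      LinearMap.add_apply, map_add]
  Y_smul a v n := LinearMap.ext fun x => by
    obtain ⟨m, rfl⟩ := hs x
    rw [LinearMap.smul_apply, ← hφ.map_Y, ← hφ.map_Y, hM.action.Y_smul, LinearMap.smul_apply,
      map_smul]
  truncation v x := by
    obtain ⟨m, rfl⟩ := hs x
    obtain ⟨N, hN⟩ := hM.action.truncation v m
    exact ⟨N, fun n hn => by rw [← hφ.map_Y, hN n hn, map_zero]⟩
  vacuum n := LinearMap.ext fun x => by
    obtain ⟨m, rfl⟩ := hs x
    rw [← hφ.map_Y, hM.action.vacuum]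
    split_ifs <;> simp
  jacobi u v l m n x := by
    obtain ⟨w, rfl⟩ := hs x
    have h := congrArg φ (hM.action.jacobi u v l m n w)
    have f1 := finite_of_truncation hM v n w (fun i => M.ops.Y u (m + l - i))
      fun i => (-1 : ℂ) ^ i * (Ring.choose l i : ℤ)
    have f2 := finite_of_truncation hM u m w (fun i => M.ops.Y v (n + l - i))
      fun i => (-1 : ℂ) ^ (l + i) * (Ring.choose l i : ℤ)
    have f3 : (Function.support fun i : ℕ => ((Ring.choose m i : ℤ) : ℂ) •
        M.ops.Y (S.Y u (l + i) v) (m + n - i) w).Finite := by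
      obtain ⟨N, hN⟩ := S.action.truncation u v
      refine (Set.finite_Iio (N - l).toNat).subset fun i hi => ?_
      by_contra hlt
      rw [Set.mem_Iio, not_lt] at hlt
      exact hi (by simp only [hN (l + i) (by omega), hM.Y_zero, LinearMap.zero_apply, smul_zero])
    rw [map_sub] at h
    refine (congrArg₂ (· - ·) ?_ ?_).trans (h.trans ?_)
    · refine Eq.trans (finsum_congr fun i => ?_) (φ.toAddMonoidHom.map_finsum f1).symm
      change _ = φ _
      rw [map_smul, hφ.map_Y, hφ.map_Y]
    · refine Eq.trans (finsum_congr fun i => ?_) (φ.toAddMonoidHom.map_finsum f2).symm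
      change _ = φ _
      rw [map_smul, hφ.map_Y, hφ.map_Y]
    · refine (φ.toAddMonoidHom.map_finsum f3).trans (finsum_congr fun i => ?_)
      change φ _ = _
      rw [map_smul, hφ.map_Y]
  sl2_zero_neg := LinearMap.ext fun x => by
    obtain ⟨m, rfl⟩ := hs x
    simpa [hφ.map_L0, hφ.map_Ln1] using congrArg φ (LinearMap.congr_fun hM.action.sl2_zero_neg m)
  sl2_zero_pos := LinearMap.ext fun x => by
    obtain ⟨m, rfl⟩ := hs x
    simpa [hφ.map_L0, hφ.map_L1] using congrArg φ (LinearMap.congr_fun hM.action.sl2_zero_pos m)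
  sl2_neg_pos := LinearMap.ext fun x => by
    obtain ⟨m, rfl⟩ := hs x
    simpa [hφ.map_L0, hφ.map_L1, hφ.map_Ln1] using
      congrArg φ (LinearMap.congr_fun hM.action.sl2_neg_pos m)
  bracket_neg v n := LinearMap.ext fun x => by
    obtain ⟨m, rfl⟩ := hs x
    simpa [hφ.map_Y, hφ.map_Ln1] using
      congrArg φ (LinearMap.congr_fun (hM.action.bracket_neg v n) m)
  bracket_zero v n := LinearMap.ext fun x => by
    obtain ⟨m, rfl⟩ := hs x
    simpa [hφ.map_Y, hφ.map_L0] using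
      congrArg φ (LinearMap.congr_fun (hM.action.bracket_zero v n) m)
  bracket_pos v n := LinearMap.ext fun x => by
    obtain ⟨m, rfl⟩ := hs x
    simpa [hφ.map_Y, hφ.map_L1] using
      congrArg φ (LinearMap.congr_fun (hM.action.bracket_pos v n) m)
  derivative v n := LinearMap.ext fun x => by
    obtain ⟨m, rfl⟩ := hs x
    simpa [hφ.map_Y] using congrArg φ (LinearMap.congr_fun (hM.action.derivative v n) m)
  conformal ω c h := by
    obtain ⟨h1, h2, h3, h4⟩ := hM.action.conformal ω c h
    refine ⟨LinearMap.ext fun x => ?_, LinearMap.ext fun x => ?_, LinearMap.ext fun x => ?_,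
      fun k l => LinearMap.ext fun x => ?_⟩
    · obtain ⟨m, rfl⟩ := hs x
      rw [← hφ.map_Y, ← hφ.map_Ln1, h1]
    · obtain ⟨m, rfl⟩ := hs x
      rw [← hφ.map_Y, ← hφ.map_L0, h2]
    · obtain ⟨m, rfl⟩ := hs x
      rw [← hφ.map_Y, ← hφ.map_L1, h3]
    · obtain ⟨m, rfl⟩ := hs x
      have := congrArg φ (LinearMap.congr_fun (h4 k l) m)
      simp only [LinearMap.sub_apply, LinearMap.add_apply, LinearMap.smul_apply,
        Module.End.mul_apply, Module.End.one_apply, map_sub, map_add, map_smul, hφ.map_Y] at this ⊢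
      exact this

/-- The image of a generalized module is a generalized module, once its `At`-homogeneous subspaces
are independent. -/
theorem IsHom.isGeneralizedModule_of_surjective (hφ : IsHom φ) (hs : Function.Surjective φ)
    (hM : M.IsGeneralizedModule S) (hind : iSupIndep P.gr) : P.IsGeneralizedModule S := by
  have hgr : IsGrading P.gr := by
    refine ⟨hind, eq_top_iff.mpr fun x _ => ?_⟩
    obtain ⟨m, rfl⟩ := hs x
    exact hM.gr_grading.le_of_forall (Q := (iSup P.gr).comap φ)
      (fun β y hy => le_iSup P.gr β (hφ.map_gr β y hy)) m
  -- Generalized eigenspaces are always independent, so only spanning has to be transported.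
  have hwt : IsGrading P.wt := by
    refine ⟨Module.End.independent_maxGenEigenspace _, eq_top_iff.mpr fun x _ => ?_⟩
    obtain ⟨m, rfl⟩ := hs x
    exact hM.wt_grading.le_of_forall (Q := (iSup P.wt).comap φ)
      (fun n y hy => le_iSup P.wt n (hφ.map_wt n y hy)) m
  have pre : ∀ β, ∀ x ∈ P.gr β, ∃ m ∈ M.gr β, φ m = x := by
    intro β x hx
    obtain ⟨m, rfl⟩ := hs x
    refine ⟨_, gradedProj_mem hM.gr_grading β m, ?_⟩
    rw [map_gradedProj hM.gr_grading hgr φ hφ.map_gr, gradedProj_of_mem hgr hx]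
  -- Bihomogeneous vectors lift to bihomogeneous vectors by projecting any lift; finite dimension
  -- and truncation then descend.
  have pre' : ∀ β n, P.gr β ⊓ P.wt n = (M.gr β ⊓ M.wt n).map φ := by
    intro β n
    refine le_antisymm ?_ ?_
    · rintro x ⟨hx, hx'⟩
      obtain ⟨m, hm, rfl⟩ := pre β x hx
      refine ⟨_, ⟨projWt_mem_gr hM hm n, gradedProj_mem hM.wt_grading n m⟩, ?_⟩
      rw [map_gradedProj hM.wt_grading hwt φ hφ.map_wt, gradedProj_of_mem hwt hx']
    · rintro _ ⟨m, hm, rfl⟩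
      exact ⟨hφ.map_gr _ _ hm.1, hφ.map_wt _ _ hm.2⟩
  refine ⟨hφ.isAction_of_surjective hs hM, hwt, hgr, fun β => ?_, fun β n => ?_, fun β n => ?_,
    fun α β v hv x hx n => ?_, fun β x hx => ?_⟩
  · refine le_antisymm (fun x hx => ?_) (iSup_le fun n => inf_le_left)
    obtain ⟨m, hm, rfl⟩ := pre β x hx
    have hle : M.gr β ≤ (⨆ n, P.gr β ⊓ P.wt n).comap φ := by
      rw [hM.compatible β]
      refine iSup_le fun n y hy => ?_
      exact le_iSup (fun n => P.gr β ⊓ P.wt n) n ⟨hφ.map_gr _ _ hy.1, hφ.map_wt _ _ hy.2⟩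
    exact hle hm
  · obtain ⟨N, hN⟩ := hM.wt_truncation β n
    exact ⟨N, fun k hk => by rw [pre', hN k hk, Submodule.map_bot]⟩
  · have := hM.finite_dim β n
    rw [pre']
    infer_instance
  · obtain ⟨m, hm, rfl⟩ := pre β x hx
    rw [← hφ.map_Y]
    exact hφ.map_gr _ _ (hM.Y_mem α β v hv m hm n)
  · obtain ⟨m, hm, rfl⟩ := pre β x hx
    rw [← hφ.map_Ln1, ← hφ.map_L0, ← hφ.map_L1]
    obtain ⟨h1, h2, h3⟩ := hM.L_mem β m hm
    exact ⟨hφ.map_gr _ _ h1, hφ.map_gr _ _ h2, hφ.map_gr _ _ h3⟩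

end Image

theorem iSupIndep_gr_of_injective (h₁ : W₁.IsGeneralizedModule S) (h₂ : W₂.IsGeneralizedModule S)
    {J : N →ₗ[ℂ] tensorDual S z W₁ W₂ h₁} (hJ : IsHom J) (hinj : Function.Injective J) :
    iSupIndep N.gr := by
  intro β
  rw [Submodule.disjoint_def]
  intro x hx hx'
  -- A sum of elements of degrees other than `β` gives a functional vanishing where `γ + δ = -β`; an
  -- element of degree `β` gives one vanishing everywhere else. An element of both kinds is
  -- therefore zero.
  let Q : Submodule ℂ N :=
    { carrier := {x | ∀ γ δ, γ + δ = -β → ∀ w₁ ∈ W₁.gr γ, ∀ w₂ ∈ W₂.gr δ,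
        dualCoe h₁ (J x) (w₁ ⊗ₜ w₂) = 0}
      zero_mem' := fun γ δ _ w₁ _ w₂ _ => by simp
      add_mem' := fun {a b} ha hb γ δ h w₁ hw₁ w₂ hw₂ => by
        rw [map_add, map_add, LinearMap.add_apply, ha γ δ h w₁ hw₁ w₂ hw₂,
          hb γ δ h w₁ hw₁ w₂ hw₂, add_zero]
      smul_mem' := fun c a ha γ δ h w₁ hw₁ w₂ hw₂ => by
        rw [map_smul, map_smul, LinearMap.smul_apply, ha γ δ h w₁ hw₁ w₂ hw₂, smul_zero] }
  have hQ : ⨆ β', ⨆ (_ : β' ≠ β), N.gr β' ≤ Q := by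
    refine iSup₂_le fun β' hβ y hy γ δ h => ?_
    exact (mem_tensorDual_gr h₁).mp (hJ.map_gr β' y hy) γ δ
      fun h' => hβ (neg_injective (h'.symm.trans h))
  have h0 := hQ hx'
  refine hinj ((dual_ext h₁ fun w₁ w₂ => ?_).trans (map_zero J).symm)
  rw [map_zero, LinearMap.zero_apply]
  refine tensor_induction h₁ h₂ (Q := LinearMap.ker (dualCoe h₁ (J x)))
    (fun γ δ w₁ hw₁ w₂ hw₂ => ?_) (w₁ ⊗ₜ w₂)
  rw [LinearMap.mem_ker]
  by_cases h : γ + δ = -β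
  · exact h0 γ δ h w₁ hw₁ w₂ hw₂
  · exact (mem_tensorDual_gr h₁).mp (hJ.map_gr β x hx) γ δ h w₁ hw₁ w₂ hw₂

theorem mem_backslash {C : ModuleData.{u} V At → Prop} (hC : IsAdmissible S C)
    (h₁ : W₁.IsGeneralizedModule S) {φ : tensorDual S z W₁ W₂ h₁} :
    φ ∈ backslash S z C W₁ W₂ h₁ ↔ ∃ (W : ModuleData.{u} V At) (hW : C W)
      (I : W₁ ⊗[ℂ] W₂ →ₗ[ℂ] (ℂ → W)) (hI : IsIntertwiningMap S z I),
      ∃ f, primeMap (hC.le W hW) h₁ I hI.mem_completion f = φ := by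
  constructor
  · rintro ⟨W, I, hW, hI, f, hf, h⟩
    exact ⟨W, hW, I, hI, contraMk _ f hf, LinearMap.ext fun w => (h w).symm⟩
  · rintro ⟨W, hW, I, hI, f, rfl⟩
    exact ⟨W, I, hW, hI, f.1, f.2, fun w => rfl⟩

end LogTensor.ModuleData

/-! ### The proposition -/

theorem mainTheorem6 {At : Type*} [AddCommGroup At] {A : AddSubgroup At}
    {V : Type*} [AddCommGroup V] [Module ℂ V]
    (S : StronglyGradedVertexAlgebra A V) (z : ℂ) (hz : z ≠ 0)
    (C : ModuleData.{u} V At → Prop) (hC : IsAdmissible S C)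
    (W₁ W₂ : ModuleData.{u} V At) (h₁ : C W₁) (h₂ : C W₂) :
    (∀ (U : Submodule ℂ (tensorDual S z W₁ W₂ (hC.le W₁ h₁)))
        (hU : IsStable (tensorDual S z W₁ W₂ (hC.le W₁ h₁)) U)
        (hobj : C (sub (tensorDual S z W₁ W₂ (hC.le W₁ h₁)) U hU)),
        U = backslash S z C W₁ W₂ (hC.le W₁ h₁) →
        ∃ I, IsPrime S (hC.le _ hobj) U.subtype I ∧
          IsPzTensorProduct S z C W₁ W₂ (contragredient S _ (hC.le _ hobj)) I) ∧
    (ClosedUnderImages S C → (∃ W₀ I₀, IsPzTensorProduct S z C W₁ W₂ W₀ I₀) →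
      ∃ (U : Submodule ℂ (tensorDual S z W₁ W₂ (hC.le W₁ h₁)))
        (hU : IsStable (tensorDual S z W₁ W₂ (hC.le W₁ h₁)) U),
        U = backslash S z C W₁ W₂ (hC.le W₁ h₁) ∧
        C (sub (tensorDual S z W₁ W₂ (hC.le W₁ h₁)) U hU)) := by
  have g₁ := hC.le W₁ h₁
  have g₂ := hC.le W₂ h₂
  refine ⟨fun U hU hobj hEq => ?_, fun hcl => ?_⟩
  · have hN := hC.le _ hobj
    have hN' := hC.le _ (hC.contragredient _ hobj)
    have hJ := isHom_subCoe U hU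
    have hinj := subCoe_injective U hU
    have hmem : ∀ φ, φ ∈ U ↔ φ ∈ backslash S z C W₁ W₂ (hC.le W₁ h₁) := fun φ => by
      rw [← hEq]; rfl
    -- Since `U` is the union of the images, each `I'` takes values in `U`; this one fact feeds both
    -- the Jacobi identity and the universal property.
    have hrange : ∀ (W : ModuleData.{u} _ _) (hW : C W) (I : W₁ ⊗[ℂ] W₂ →ₗ[ℂ] (ℂ → W))
        (hI : IsIntertwiningMap S z I) (f : W.contragredient S (hC.le W hW)),
        ∃ y, subCoe U hU y = primeMap (hC.le W hW) g₁ I hI.mem_completion f := by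
      intro W hW I hI f
      rw [exists_subCoe_eq, hmem, mem_backslash hC]
      exact ⟨W, hW, I, hI, f, rfl⟩
    refine ⟨evalMap g₁ g₂ hN hJ, ⟨evalMap_mem_wt g₁ g₂ hN hJ hN', fun w x =>
      finsum_evalMap g₁ g₂ hN hJ w x⟩, hC.contragredient _ hobj,
      evalMap_intertwining g₁ g₂ hN hJ (hN' := hN') hinj (fun _ _ h => h) fun x => ?_,
      fun W I hW hI => ?_⟩
    · obtain ⟨W, hW, I, hI, f, hf⟩ := (mem_backslash hC _).mp ((hmem _).mp
        ((exists_subCoe_eq U hU).mp ⟨x, rfl⟩))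
      exact ⟨W, hC.le W hW, hC.le _ (hC.contragredient W hW), I, hI, ⟨f, hf⟩,
        hrange W hW I hI⟩
    · exact existsUnique_hom_of_evalMap g₁ g₂ hN hJ hinj (fun _ _ h => h) (hC.le W hW)
        (hC.le _ (hC.contragredient W hW)) hI (hrange W hW I hI)
  · rintro ⟨W₀, I₀, hT⟩
    have hW₀ := hC.le W₀ hT.mem
    have hW₀' := hC.le _ (hC.contragredient W₀ hT.mem)
    have hP := hT.intertwining.isHom_primeMap hW₀ hW₀' g₁ g₂
    have hU := hP.isStable_range
    refine ⟨_, hU, Set.ext fun φ => ?_, ?_⟩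
    · rw [mem_backslash hC]
      constructor
      · rintro ⟨f, hf⟩
        exact ⟨W₀, hT.mem, I₀, hT.intertwining, f, hf⟩
      · rintro ⟨W, hW, I, hI, f, rfl⟩
        obtain ⟨η, ⟨hη, hηI⟩, -⟩ := hT.universal W I hW hI
        -- `I'(f) = I₀'(f ∘ η)`, because `I = η̄ ∘ I₀`.
        refine ⟨contraMk hW₀ _ (hη.comp_mem_contraSpace (contraCoe_mem (hC.le W hW) f)), ?_⟩
        refine dual_ext g₁ fun w₁ w₂ => ?_
        rw [primeMap_apply, primeMap_apply]
        exact finsum_congr fun n => by rw [contraCoe_mk, LinearMap.comp_apply, hηI]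
    -- `K` is `I₀'` with its target cut down to the image. As `(W₁ ⊗ W₂)^*` need not be a
    -- generalized module, closure under images is applied to the surjection `K`, after its target
    -- has been shown to be one.
    · obtain ⟨K, hK, hJK⟩ := (isHom_subCoe _ hU).exists_lift (subCoe_injective _ hU)
        (fun _ _ h => h) hP fun m => (exists_subCoe_eq _ hU).mpr ⟨m, rfl⟩
      have hs : Function.Surjective K := by
        intro y
        obtain ⟨m, hm⟩ := (exists_subCoe_eq _ hU).mp ⟨y, rfl⟩
        exact ⟨m, subCoe_injective _ hU ((hJK m).trans hm)⟩
      have hgen := hK.isGeneralizedModule_of_surjective hs hW₀'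
        (iSupIndep_gr_of_injective g₁ g₂ (isHom_subCoe _ hU) (subCoe_injective _ hU))
      refine hcl _ _ _ K LinearMap.id (hC.contragredient W₀ hT.mem) hgen hgen hK
        ⟨fun _ _ _ => rfl, fun _ => rfl, fun _ => rfl, fun _ => rfl, fun _ _ h => h⟩
        Function.injective_id ?_
      rw [LinearMap.range_id, LinearMap.range_eq_top.mpr hs]
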